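/- Let $[a,b]$, $-\infty<a<b<\infty$, be a finite interval, and let $V\in L^\infty([a,b],\mathbb R^{n\times n})$ with $V(x)^\top=V(x)$ for almost every $x$. For $\theta\in[0,2\pi)$ let $H_\theta=(-\partial_x^2)_\theta+V$ in $L^2([a,b],\mathbb C^n)$, where $(-\partial_x^2)_\theta u=-u''$ on the domain of all $u\in L^2([a,b],\mathbb C^n)$ such that $u,u'$ are absolutely continuous on $[a,b]$, $u''\in L^2([a,b],\mathbb C^n)$, $u(b)=e^{\mathrm i\theta}u(a)$ and $u'(b)=e^{\mathrm i\theta}u'(a)$. Put $$N(r,\theta)=\sum_{\lambda<r}\dim_{\mathbb C}\ker(H_\theta-\lambda),\qquad N([r_1,r_2),\theta)=\sum_{r_1\le\lambda<r_2}\dim_{\mathbb C}\ker(H_\theta-\lambda).$$ These numbers are well defined: for every $\theta\in[0,2\pi)$ each $\ker(H_\theta-\lambda)$, $\lambda\in\mathbb R$, is finite dimensional, and for every $r\in\mathbb R$ only finitely many $\lambda<r$ are eigenvalues of $H_\theta$. Moreover, for all $r\in\mathbb R$ and all real $r_1<r_2$: (i) if $0\le\theta_1<\theta_2<2\pi$,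 then $$|N(r,\theta_2)-N(r,\theta_1)|\le 2n,\qquad |N([r_1,r_2),\theta_2)-N([r_1,r_2),\theta_1)|\le 4n;$$ (ii) if $0<\theta_1<\theta_2<\pi$ or $\pi<\theta_1<\theta_2<2\pi$, then $$|N(r,\theta_2)-N(r,\theta_1)|\le n,\qquad |N([r_1,r_2),\theta_2)-N([r_1,r_2),\theta_1)|\le 2n.$$ -/

import Mathlib

open MeasureTheory Set

noncomputable section

namespace ThetaSchrodinger

/-- The complex Hilbert space `ℂⁿ`. -/
abbrev Cn (n : ℕ) : Type := EuclideanSpace ℂ (Fin n)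

/-- The Hilbert space `L²([a,b], ℂⁿ)`. -/
abbrev L2 (n : ℕ) (a b : ℝ) : Type := Lp (Cn n) 2 (volume.restrict (Icc a b))

/-- The action of a real `n × n` matrix on a vector of `ℂⁿ`. -/
def matAct {n : ℕ} (M : Matrix (Fin n) (Fin n) ℝ) (z : Cn n) : Cn n :=
  WithLp.toLp 2 ((M.map (fun t : ℝ => (t : ℂ))).mulVec z.ofLp)

/-- `f` is a representative of `u` such that `f` and `f' = g` are absolutely continuous on
`[a,b]`, with `f'' = g' = -w` almost everywhere (so that `f'' ∈ L²`, as `w ∈ L²`), and such that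
`f(b) = e^{iθ} f(a)` and `f'(b) = e^{iθ} f'(a)`. -/
structure IsLaplacianPair {n : ℕ} (a b θ : ℝ) (f g : ℝ → Cn n) (u w : L2 n a b) : Prop where
  rep : ∀ᵐ x ∂(volume.restrict (Icc a b)), u x = f x
  ac : AbsolutelyContinuousOnInterval f a b
  ac' : AbsolutelyContinuousOnInterval g a b
  deriv : ∀ x ∈ Icc a b, HasDerivWithinAt f (g x) (Icc a b) x
  deriv' : ∀ᵐ x ∂(volume.restrict (Icc a b)), HasDerivAt g (-(w x)) x
  bc : f b = Complex.exp (Complex.I * θ) • f a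
  bc' : g b = Complex.exp (Complex.I * θ) • g a

/-- The graph `{(u, -u'') : u ∈ dom}` of the operator `(-∂ₓ²)_θ`. -/
def laplacianGraph (n : ℕ) (a b θ : ℝ) : Submodule ℂ (L2 n a b × L2 n a b) where
  carrier := {p | ∃ f g : ℝ → Cn n, IsLaplacianPair a b θ f g p.1 p.2}
  zero_mem' := by
    have hz := Lp.coeFn_zero (Cn n) 2 (volume.restrict (Icc a b))
    refine ⟨fun _ => 0, fun _ => 0, ?_, ?_, ?_, ?_, ?_, ?_, ?_⟩
    · filter_upwards [hz] with x hx
      simpa using hx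
    · exact ((LipschitzWith.const (0 : Cn n)).lipschitzOnWith).absolutelyContinuousOnInterval
    · exact ((LipschitzWith.const (0 : Cn n)).lipschitzOnWith).absolutelyContinuousOnInterval
    · exact fun x _ => hasDerivWithinAt_const x _ 0
    · filter_upwards [hz] with x hx
      have h0 : ((0 : L2 n a b × L2 n a b).2 : ℝ → Cn n) x = 0 := by simpa using hx
      rw [h0, neg_zero]
      exact hasDerivAt_const x 0
    · simp
    · simp
  add_mem' := by
    rintro ⟨u, w⟩ ⟨u₂, w₂⟩ ⟨f, g, h⟩ ⟨f₂, g₂, k⟩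
    refine ⟨f + f₂, g + g₂, ?_, h.ac.add k.ac, h.ac'.add k.ac',
      fun x hx => (h.deriv x hx).add (k.deriv x hx), ?_, ?_, ?_⟩
    · filter_upwards [h.rep, k.rep, Lp.coeFn_add u u₂] with x h1 h2 h3
      simp only [Prod.mk_add_mk, Pi.add_apply] at *
      rw [h3, h1, h2]
    · filter_upwards [h.deriv', k.deriv', Lp.coeFn_add w w₂] with x h1 h2 h3
      simp only [Prod.mk_add_mk, Pi.add_apply] at *
      rw [h3, neg_add]
      exact h1.add h2
    · simp only [Pi.add_apply, h.bc, k.bc, smul_add]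
    · simp only [Pi.add_apply, h.bc', k.bc', smul_add]
  smul_mem' := by
    rintro c ⟨u, w⟩ ⟨f, g, h⟩
    refine ⟨fun x => c • f x, fun x => c • g x, ?_, h.ac.const_smul c, h.ac'.const_smul c,
      fun x hx => (h.deriv x hx).const_smul c, ?_, ?_, ?_⟩
    · filter_upwards [h.rep, Lp.coeFn_smul c u] with x h1 h2
      simp only [Prod.smul_mk, Pi.smul_apply] at *
      rw [h2, h1]
    · filter_upwards [h.deriv', Lp.coeFn_smul c w] with x h1 h2
      simp only [Prod.smul_mk, Pi.smul_apply] at *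
      rw [h2, ← smul_neg]
      exact h1.const_smul c
    · simp only [h.bc, smul_comm c]
    · simp only [h.bc', smul_comm c]

/-- The unbounded operator `(-∂ₓ²)_θ` in `L²([a,b], ℂⁿ)`: its domain consists of the `u` with
`u, u'` absolutely continuous, `u'' ∈ L²`, `u(b) = e^{iθ}u(a)`, `u'(b) = e^{iθ}u'(a)`, and it maps
`u` to `-u''`. -/
def laplacian (n : ℕ) (a b θ : ℝ) : L2 n a b →ₗ.[ℂ] L2 n a b :=
  (laplacianGraph n a b θ).toLinearPMap

/-- The graph `{(u, V u)}` of the operator of multiplication by `V`. -/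
def potentialGraph {n : ℕ} (a b : ℝ) (V : ℝ → Matrix (Fin n) (Fin n) ℝ) :
    Submodule ℂ (L2 n a b × L2 n a b) where
  carrier := {p | ∀ᵐ x ∂(volume.restrict (Icc a b)), p.2 x = matAct (V x) (p.1 x)}
  zero_mem' := by
    filter_upwards [Lp.coeFn_zero (Cn n) 2 (volume.restrict (Icc a b))] with x hx
    simp only [Prod.fst_zero, Prod.snd_zero, hx]
    simp [matAct]
  add_mem' := by
    rintro ⟨u, w⟩ ⟨u₂, w₂⟩ h k
    filter_upwards [h, k, Lp.coeFn_add u u₂, Lp.coeFn_add w w₂] with x h1 h2 h3 h4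
    simp only [Prod.mk_add_mk, Pi.add_apply] at *
    rw [h4, h3, h1, h2]
    simp [matAct, Matrix.mulVec_add]
  smul_mem' := by
    rintro c ⟨u, w⟩ h
    filter_upwards [h, Lp.coeFn_smul c u, Lp.coeFn_smul c w] with x h1 h2 h3
    simp only [Prod.smul_mk, Pi.smul_apply] at *
    rw [h3, h2, h1]
    simp [matAct, Matrix.mulVec_smul]

/-- The operator of multiplication by the matrix potential `V` in `L²([a,b], ℂⁿ)`, on its maximal
domain `{u : V u ∈ L²}` (which is the whole space when `V` is essentially bounded). -/
def potential {n : ℕ} (a b : ℝ) (V : ℝ → Matrix (Fin n) (Fin n) ℝ) :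
    L2 n a b →ₗ.[ℂ] L2 n a b :=
  (potentialGraph a b V).toLinearPMap

/-- The Schrödinger operator `H_θ = (-∂ₓ²)_θ + V`. -/
def schrodinger {n : ℕ} (a b : ℝ) (V : ℝ → Matrix (Fin n) (Fin n) ℝ) (θ : ℝ) :
    L2 n a b →ₗ.[ℂ] L2 n a b :=
  laplacian n a b θ + potential a b V

/-- `ker (T - z)`, for an unbounded operator `T`, as a subspace of the ambient space. -/
def eigenspace {E : Type*} [AddCommGroup E] [Module ℂ E] (T : E →ₗ.[ℂ] E) (z : ℂ) :
    Submodule ℂ E :=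
  (LinearMap.ker (T.toFun - z • T.domain.subtype)).map T.domain.subtype

/-- `dim_ℂ ker (H_θ - l)` for real `l`. -/
def mult {n : ℕ} (a b : ℝ) (V : ℝ → Matrix (Fin n) (Fin n) ℝ) (θ l : ℝ) : ℕ :=
  Module.finrank ℂ (eigenspace (schrodinger a b V θ) (l : ℂ))

/-- `N(r,θ)`: the number of eigenvalues of `H_θ` smaller than `r`, with multiplicity. -/
def count {n : ℕ} (a b : ℝ) (V : ℝ → Matrix (Fin n) (Fin n) ℝ) (r θ : ℝ) : ℕ :=
  ∑ᶠ l ∈ Iio r, mult a b V θ l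

/-- `N([r₁,r₂),θ)`: the number of eigenvalues of `H_θ` in `[r₁,r₂)`, with multiplicity. -/
def countIco {n : ℕ} (a b : ℝ) (V : ℝ → Matrix (Fin n) (Fin n) ℝ) (r₁ r₂ θ : ℝ) : ℕ :=
  ∑ᶠ l ∈ Ico r₁ r₂, mult a b V θ l

/-- `-u''` is uniquely determined by `u`, so `laplacian` is the operator with graph
`laplacianGraph`. -/
theorem laplacian_graph (n : ℕ) (a b θ : ℝ) :
    (laplacian n a b θ).graph = laplacianGraph n a b θ := by
  refine Submodule.toLinearPMap_graph_eq _ ?_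
  rintro ⟨u, w⟩ ⟨f, g, h⟩ hu
  simp only at hu h
  subst hu
  rcases le_or_gt b a with hab | hab
  · have h0 : volume.restrict (Icc a b) = 0 := by
      rw [Measure.restrict_eq_zero, Real.volume_Icc]
      simpa using hab
    refine Lp.ext ?_
    have h1 : ae (volume.restrict (Icc a b)) = ⊥ := by rw [h0, ae_zero]
    rw [Filter.EventuallyEq, h1]
    exact Filter.eventually_bot
  have hc : ContinuousOn f (Icc a b) := fun x hx => (h.deriv x hx).continuousWithinAt
  have hf : EqOn f (fun _ => 0) (Icc a b) := by
    refine Measure.eqOn_Icc_of_ae_eq volume hab.ne ?_ hc continuousOn_const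
    filter_upwards [h.rep, Lp.coeFn_zero (Cn n) 2 (volume.restrict (Icc a b))] with x h1 h2
    rw [← h1, h2]
    rfl
  have hg : ∀ x ∈ Icc a b, g x = 0 := by
    intro x hx
    have h1 : HasDerivWithinAt f 0 (Icc a b) x :=
      (hasDerivWithinAt_const x (Icc a b) (0 : Cn n)).congr hf (hf hx)
    exact (uniqueDiffOn_Icc hab x hx).eq_deriv _ (h.deriv x hx) h1
  refine Lp.ext ?_
  have hIoo : ∀ᵐ x ∂(volume.restrict (Icc a b)), x ∈ Ioo a b := by
    rw [← restrict_Ioo_eq_restrict_Icc]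
    exact ae_restrict_mem measurableSet_Ioo
  filter_upwards [h.deriv', hIoo, Lp.coeFn_zero (Cn n) 2 (volume.restrict (Icc a b))]
    with x h1 h2 h3
  have h4 : HasDerivAt g 0 x := by
    refine (hasDerivAt_const x (0 : Cn n)).congr_of_eventuallyEq ?_
    filter_upwards [Icc_mem_nhds h2.1 h2.2] with y hy using hg y hy
  rw [h3]
  simpa using h1.unique h4

/-- `V u` is uniquely determined by `u`. -/
theorem potential_graph {n : ℕ} (a b : ℝ) (V : ℝ → Matrix (Fin n) (Fin n) ℝ) :
    (potential a b V).graph = potentialGraph a b V := by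
  refine Submodule.toLinearPMap_graph_eq _ ?_
  rintro ⟨u, w⟩ h hu
  simp only at hu
  subst hu
  refine Lp.ext ?_
  filter_upwards [h, Lp.coeFn_zero (Cn n) 2 (volume.restrict (Icc a b))] with x h1 h2
  rw [h1, h2]
  simp [matAct]

end ThetaSchrodinger

end

/-!
The bounds follow from a variational comparison with the functions vanishing at both endpoints,
which gives the constant `n` (and `2n` for intervals) for every pair of quasi-momenta.

The form domain of `H_θ` consists of the `u ∈ H¹` with `u(b) = e^{iθ} u(a)`, and the form
`∫ |u'|² + ⟪u, V u⟫` does not depend on `θ`. Let `W₁` be the span of the eigenvectors of `H_{θ₁}`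
below `r`. The vectors of `W₁` with `u(a) = 0` form a subspace of codimension at most `n`; they
satisfy `u(a) = u(b) = 0`, so they lie in the form domain of `H_{θ₂}` as well. On nonzero vectors of
`W₁` the form is smaller than `r ‖u‖²`, whereas on vectors of the form domain of `H_{θ₂}` orthogonal
to the eigenvectors of `H_{θ₂}` below `r` it is at least `r ‖u‖²`. Hence
`N(r, θ₁) ≤ N(r, θ₂) + n`, by a dimension count (`finrank_spectralBelow_le`).

To have the spectral theorem at hand, `H¹` is parametrized by the pairs `(u', u(a))` in the Hilbert
space `L² × ℂⁿ`, on which the form shifted by a large `c` is represented by a bounded coercive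
operator `formOp`, and the embedding `embL` in `L²` is compact by Arzelà–Ascoli. The Lax–Milgram
theorem on the closed subspace `formDomain` gives a compact positive operator `G` in `L²`
(`exists_isFormResolvent`), and `G = (H_θ + c)⁻¹`: a weak solution is a strong one, with the boundary
condition for `u'` (`mem_laplacianGraph_iff_weak`). The eigenspace of `H_θ` at `l` is thus
`{u | (l + c) G u = u}` (`eigenspace_schrodinger_eq`), and finiteness and the two variational
inequalities are statements about compact positive operators (`finiteDimensional_spectralBelow`,
`re_inner_lt_of_mem_spectralBelow`, `IsFormResolvent.le_re_inner`).
-/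

noncomputable section

namespace ThetaSchrodinger

open scoped InnerProductSpace Topology

/-! ### Spectral subspaces of an operator with compact positive inverse -/

section Spectral

variable {L : Type*} [NormedAddCommGroup L] [InnerProductSpace ℂ L]

/-- The eigenspace at `l` of the (possibly unbounded) operator `H` with `(H + c)⁻¹ = G`, written in
terms of `G` only: the vectors `u` with `(l + c) G u = u`. -/
def invEigenspace (G : L →L[ℂ] L) (c l : ℝ) : Submodule ℂ L :=
  LinearMap.ker (((l + c : ℝ) : ℂ) • (G : L →ₗ[ℂ] L) - LinearMap.id)

theorem mem_invEigenspace {G : L →L[ℂ] L} {c l : ℝ} {u : L} :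
    u ∈ invEigenspace G c l ↔ ((l + c : ℝ) : ℂ) • G u = u := by
  simp only [invEigenspace, LinearMap.mem_ker, LinearMap.sub_apply, LinearMap.smul_apply,
    LinearMap.id_apply, sub_eq_zero, ContinuousLinearMap.coe_coe]

/-- The span of the eigenvectors of `G⁻¹ - c` with eigenvalue below `r`. -/
def spectralBelow (G : L →L[ℂ] L) (c r : ℝ) : Submodule ℂ L :=
  ⨆ l : Iio r, invEigenspace G c l

variable {G : L →L[ℂ] L} {c r : ℝ}

/-- At `l = -c` both sides vanish, in accordance with `0⁻¹ = 0`. -/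
theorem apply_of_mem_invEigenspace {l : ℝ} {u : L} (hu : u ∈ invEigenspace G c l) :
    G u = (((l + c)⁻¹ : ℝ) : ℂ) • u := by
  rw [mem_invEigenspace] at hu
  rcases eq_or_ne (l + c) 0 with h | h
  · rw [h, Complex.ofReal_zero, zero_smul] at hu
    simp [← hu]
  · nth_rewrite 2 [← hu]
    rw [smul_smul, ← Complex.ofReal_mul, inv_mul_cancel₀ h, Complex.ofReal_one, one_smul]

theorem orthogonalFamily_invEigenspace (hG : G.IsPositive) :
    OrthogonalFamily ℂ (fun l : ℝ => invEigenspace G c l)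
      fun l => (invEigenspace G c l).subtypeₗᵢ := by
  rintro l m hlm ⟨u, hu⟩ ⟨v, hv⟩
  change ⟪u, v⟫_ℂ = 0
  rw [mem_invEigenspace] at hu hv
  have h1 : ⟪u, v⟫_ℂ = ((l + c : ℝ) : ℂ) * ⟪G u, v⟫_ℂ := by
    conv_lhs => rw [← hu]
    rw [inner_smul_left, Complex.conj_ofReal]
  have h2 : ⟪u, v⟫_ℂ = ((m + c : ℝ) : ℂ) * ⟪G u, v⟫_ℂ := by
    conv_lhs => rw [← hv]
    rw [inner_smul_right, hG.inner_left_eq_inner_right]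
  have h3 : ((l - m : ℝ) : ℂ) * ⟪G u, v⟫_ℂ = 0 := by
    have : ((l + c : ℝ) : ℂ) * ⟪G u, v⟫_ℂ = ((m + c : ℝ) : ℂ) * ⟪G u, v⟫_ℂ := h1.symm.trans h2
    push_cast at this ⊢
    linear_combination this
  rcases mul_eq_zero.1 h3 with h | h
  · exact absurd (sub_eq_zero.1 (Complex.ofReal_eq_zero.1 h)) hlm
  · rw [h1, h, mul_zero]

theorem orthogonalFamily_invEigenspace_Iio (hG : G.IsPositive) :
    OrthogonalFamily ℂ (fun l : Iio r => invEigenspace G c l)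
      fun l => (invEigenspace G c l).subtypeₗᵢ :=
  (orthogonalFamily_invEigenspace hG).comp Subtype.val_injective

theorem pos_of_mem_invEigenspace (hG : G.IsPositive) {l : ℝ} {u : L}
    (hu : u ∈ invEigenspace G c l) (h0 : u ≠ 0) : 0 < l + c := by
  rw [mem_invEigenspace] at hu
  have h1 : (‖u‖ ^ 2 : ℝ) = (l + c) * RCLike.re ⟪G u, u⟫_ℂ := by
    rw [← inner_self_eq_norm_sq (𝕜 := ℂ)]
    nth_rewrite 1 [← hu]
    rw [inner_smul_left, Complex.conj_ofReal]
    simp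
  have h2 : 0 < (‖u‖ ^ 2 : ℝ) := by positivity
  rw [h1] at h2
  exact pos_of_mul_pos_left h2 (hG.re_inner_nonneg_left u)

/-- On the span of the eigenvectors of `G⁻¹ - c` below `r`, the operator `G` is larger than
`(r + c)⁻¹`. -/
theorem norm_sq_lt_of_mem_spectralBelow (hG : G.IsPositive) {u : L}
    (hu : u ∈ spectralBelow G c r) (h0 : u ≠ 0) :
    ‖u‖ ^ 2 < (r + c) * RCLike.re ⟪G u, u⟫_ℂ := by
  obtain ⟨f, hf, rfl⟩ := (Submodule.mem_iSup_iff_exists_finsupp _ _).1 hu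
  have hV := orthogonalFamily_invEigenspace_Iio (G := G) (c := c) (r := r) hG
  let v : ∀ l : Iio r, invEigenspace G c l := fun l => ⟨f l, hf l⟩
  let w : ∀ l : Iio r, invEigenspace G c l := fun l => (((l + c)⁻¹ : ℝ) : ℂ) • v l
  have hsum : (f.sum fun _ x => x) = ∑ l ∈ f.support, (invEigenspace G c l).subtypeₗᵢ (v l) := rfl
  have hGsum : G (f.sum fun _ x => x) = ∑ l ∈ f.support, (invEigenspace G c l).subtypeₗᵢ (w l) := by
    rw [hsum, map_sum]
    exact Finset.sum_congr rfl fun l _ => apply_of_mem_invEigenspace (hf l)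
  have hne : f.support.Nonempty := by
    rw [Finset.nonempty_iff_ne_empty]
    intro h
    exact h0 (by rw [hsum, h, Finset.sum_empty])
  rw [hGsum, hsum, hV.norm_sum, hV.inner_sum, map_sum, Finset.mul_sum]
  refine Finset.sum_lt_sum_of_nonempty hne fun l hl => ?_
  have hl0 : f l ≠ 0 := Finsupp.mem_support_iff.1 hl
  have hpos := pos_of_mem_invEigenspace hG (hf l) hl0
  have hlt : (l : ℝ) + c < r + c := by linarith [l.2.out]
  have hv : (0 : ℝ) < ‖v l‖ ^ 2 := by
    have : ‖v l‖ = ‖f l‖ := rfl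
    rw [this]; positivity
  have : RCLike.re ⟪w l, v l⟫_ℂ = ((l : ℝ) + c)⁻¹ * ‖v l‖ ^ 2 := by
    simp only [w]
    rw [inner_smul_left, Complex.conj_ofReal, ← inner_self_eq_norm_sq (𝕜 := ℂ),
      RCLike.re_to_complex, RCLike.re_to_complex, Complex.re_ofReal_mul]
  rw [this, ← mul_assoc]
  have h1 : 1 < (r + c) * ((l : ℝ) + c)⁻¹ := by
    rw [← div_eq_mul_inv, one_lt_div hpos]; exact hlt
  nlinarith

/-- The quadratic form of `G⁻¹ - c` is smaller than `r` on the vectors `G u`. -/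
theorem re_inner_lt_of_mem_spectralBelow (hG : G.IsPositive) (hr : 0 < r + c) {u : L}
    (hu : u ∈ spectralBelow G c r) (h0 : u ≠ 0) :
    RCLike.re ⟪G u, u⟫_ℂ < (r + c) * ‖G u‖ ^ 2 := by
  have h1 := norm_sq_lt_of_mem_spectralBelow hG hu h0
  have h2 : RCLike.re ⟪G u, u⟫_ℂ ≤ ‖G u‖ * ‖u‖ := re_inner_le_norm _ _
  have hu0 : 0 < ‖u‖ := norm_pos_iff.2 h0
  have h3 : ‖u‖ < (r + c) * ‖G u‖ := by
    by_contra! h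
    nlinarith
  have h4 : 0 < ‖G u‖ := by
    by_contra! h
    nlinarith
  nlinarith

theorem norm_le_of_mem_spectralBelow (hG : G.IsPositive) (hr : 0 < r + c) {u : L}
    (hu : u ∈ spectralBelow G c r) : ‖u‖ ≤ (r + c) * ‖G u‖ := by
  rcases eq_or_ne u 0 with rfl | h0
  · simp
  have h1 := norm_sq_lt_of_mem_spectralBelow hG hu h0
  have h2 : RCLike.re ⟪G u, u⟫_ℂ ≤ ‖G u‖ * ‖u‖ := re_inner_le_norm _ _
  have hu0 : 0 < ‖u‖ := norm_pos_iff.2 h0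
  by_contra! h
  nlinarith

theorem apply_mem_spectralBelow {u : L} (hu : u ∈ spectralBelow G c r) :
    G u ∈ spectralBelow G c r := by
  have h : spectralBelow G c r ≤ (spectralBelow G c r).comap (G : L →ₗ[ℂ] L) := by
    refine iSup_le fun l v hv => ?_
    rw [Submodule.mem_comap, ContinuousLinearMap.coe_coe, apply_of_mem_invEigenspace hv]
    exact Submodule.smul_mem _ _ (Submodule.mem_iSup_of_mem l hv)
  exact h hu

/-- The closure of the span is an invariant subspace on which the compact operator `G` is bounded
below, hence it is finite dimensional. -/
theorem finiteDimensional_spectralBelow [CompleteSpace L] (hG : G.IsPositive)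
    (hGc : IsCompactOperator G) (hr : 0 < r + c) : FiniteDimensional ℂ (spectralBelow G c r) := by
  set W := (spectralBelow G c r).topologicalClosure with hW
  have hWc : IsClosed (W : Set L) := Submodule.isClosed_topologicalClosure _
  have : CompleteSpace W := hWc.completeSpace_coe
  have hinv : ∀ u ∈ W, G u ∈ W := fun u hu =>
    map_mem_closure G.continuous hu fun v hv => apply_mem_spectralBelow hv
  have hbound : ∀ u ∈ W, ‖u‖ ≤ (r + c) * ‖G u‖ := by
    intro u hu
    have hcl : IsClosed {u : L | ‖u‖ ≤ (r + c) * ‖G u‖} :=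
      isClosed_le continuous_norm (continuous_const.mul G.continuous.norm)
    exact closure_minimal (fun v hv => norm_le_of_mem_spectralBelow hG hr hv) hcl hu
  let S : W →L[ℂ] W := G.restrict hinv
  have hSc : IsCompactOperator S := hGc.restrict' (f := (G : L →ₗ[ℂ] L)) hinv
  have hS : AntilipschitzWith (r + c).toNNReal S := by
    refine S.antilipschitz_of_bound fun u => ?_
    rw [Real.coe_toNNReal _ hr.le]
    exact hbound u u.2
  have hemb : Topology.IsClosedEmbedding S := hS.isClosedEmbedding S.uniformContinuous
  have hid : IsCompactOperator (id : W → W) := by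
    obtain ⟨K, hK, hKn⟩ := hSc
    exact ⟨S ⁻¹' K, hemb.isCompact_preimage hK, hKn⟩
  have : FiniteDimensional ℂ W := FiniteDimensional.of_isCompactOperator_id (𝕜 := ℂ) hid
  exact Submodule.finiteDimensional_of_le (Submodule.le_topologicalClosure _)

theorem finiteDimensional_invEigenspace [CompleteSpace L] (hG : G.IsPositive)
    (hGc : IsCompactOperator G) (hr : 0 < r + c) {l : ℝ} (hl : l < r) :
    FiniteDimensional ℂ (invEigenspace G c l) := by
  have := finiteDimensional_spectralBelow hG hGc hr
  exact Submodule.finiteDimensional_of_le (S₂ := spectralBelow G c r)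
    (le_iSup (fun l : Iio r => invEigenspace G c l) ⟨l, hl⟩)

theorem finite_setOf_invEigenspace_ne_bot [CompleteSpace L] (hG : G.IsPositive)
    (hGc : IsCompactOperator G) (hr : 0 < r + c) :
    {l : ℝ | l < r ∧ invEigenspace G c l ≠ ⊥}.Finite := by
  have := finiteDimensional_spectralBelow hG hGc hr
  have h (l : {l : ℝ | l < r ∧ invEigenspace G c l ≠ ⊥}) :
      ∃ v ∈ invEigenspace G c l, v ≠ 0 := Submodule.exists_mem_ne_zero_of_ne_bot l.2.2
  choose v hv hv0 using h
  have hmem : ∀ l, v l ∈ spectralBelow G c r := fun l =>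
    Submodule.mem_iSup_of_mem (p := fun l : Iio r => invEigenspace G c l) ⟨l, l.2.1⟩ (hv l)
  let w : {l : ℝ | l < r ∧ invEigenspace G c l ≠ ⊥} → spectralBelow G c r :=
    fun l => ⟨v l, hmem l⟩
  have hw : LinearIndependent ℂ w := by
    refine linearIndependent_of_ne_zero_of_inner_eq_zero (fun l h => ?_) fun l m hlm => ?_
    · exact hv0 l (congrArg Subtype.val h)
    · exact orthogonalFamily_invEigenspace hG (fun h => hlm (Subtype.ext h))
        ⟨v l, hv l⟩ ⟨v m, hv m⟩
  exact Set.finite_coe_iff.1 (hw.finite_of_isNoetherian)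

theorem finsum_finrank_invEigenspace [CompleteSpace L] (hG : G.IsPositive)
    (hGc : IsCompactOperator G) (hr : 0 < r + c) :
    ∑ᶠ l ∈ Iio r, Module.finrank ℂ (invEigenspace G c l)
      = Module.finrank ℂ (spectralBelow G c r) := by
  have hfin := finite_setOf_invEigenspace_ne_bot hG hGc hr
  set S := {l : ℝ | l < r ∧ invEigenspace G c l ≠ ⊥} with hS
  let _ : Fintype S := hfin.fintype
  have hSup : spectralBelow G c r = ⨆ l : S, invEigenspace G c l := by
    refine le_antisymm (iSup_le fun l => ?_) (iSup_le fun l => ?_)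
    · by_cases h : invEigenspace G c (l : ℝ) = ⊥
      · rw [h]; exact bot_le
      · exact le_iSup (fun l : S => invEigenspace G c l) ⟨l, l.2, h⟩
    · exact le_iSup (fun l : Iio r => invEigenspace G c l) ⟨l, l.2.1⟩
  have hind : iSupIndep fun l : S => invEigenspace G c l :=
    ((orthogonalFamily_invEigenspace hG).comp Subtype.val_injective).independent
  classical
  have (l : S) : FiniteDimensional ℂ (invEigenspace G c (l : ℝ)) :=
    finiteDimensional_invEigenspace hG hGc hr l.2.1
  have h1 : Module.finrank ℂ (spectralBelow G c r)
      = ∑ l : S, Module.finrank ℂ (invEigenspace G c l) := by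
    rw [hSup, Submodule.iSup_eq_range_dfinsupp_lsum,
      LinearMap.finrank_range_of_inj hind.dfinsupp_lsum_injective]
    exact Module.finrank_directSum ℂ fun l : S => invEigenspace G c (l : ℝ)
  have h2 : ∑ᶠ l ∈ Iio r, Module.finrank ℂ (invEigenspace G c l)
      = ∑ᶠ l ∈ S, Module.finrank ℂ (invEigenspace G c l) := by
    refine finsum_mem_inter_support_eq _ _ _
      (Set.ext fun l => ⟨fun h => ⟨⟨h.1, fun h0 => ?_⟩, h.2⟩, fun h => ⟨h.1.1, h.2⟩⟩)
    refine h.2 ?_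
    change Module.finrank ℂ (invEigenspace G c l) = 0
    rw [h0, finrank_bot]
  rw [h2, h1, finsum_mem_eq_finite_toFinset_sum _ hfin, Finset.sum_subtype _ (p := (· ∈ S))]
  intro l
  exact hfin.mem_toFinset

/-- On the orthogonal complement of the eigenvectors of `G⁻¹ - c` below `r`, the operator `G` is at
most `(r + c)⁻¹`: the restriction of `G` is compact and self-adjoint, so that its norm is its
spectral radius, and all its nonzero spectral values are eigenvalues. -/
theorem re_inner_le_of_mem_orthogonal [CompleteSpace L] (hG : G.IsPositive)
    (hGc : IsCompactOperator G) (hr : 0 < r + c) {u : L} (hu : u ∈ (spectralBelow G c r)ᗮ) :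
    (r + c) * RCLike.re ⟪G u, u⟫_ℂ ≤ ‖u‖ ^ 2 := by
  set W := (spectralBelow G c r)ᗮ with hW
  have hinv : ∀ u ∈ W, G u ∈ W := fun u hu v hv => by
    rw [← hG.inner_left_eq_inner_right]
    exact hu _ (apply_mem_spectralBelow hv)
  let S : W →L[ℂ] W := G.restrict hinv
  have hSc : IsCompactOperator S := hGc.restrict' (f := (G : L →ₗ[ℂ] L)) hinv
  have hSs : S.IsSymmetric := hG.isSymmetric.restrict_invariant hinv
  have hnorm : ‖S‖ ≤ (r + c)⁻¹ := by
    have hle : (‖S‖₊ : ENNReal) ≤ ((r + c)⁻¹).toNNReal := by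
      rw [← S.spectralRadius_eq_nnnorm hSs.isSelfAdjoint, spectralRadius]
      refine iSup₂_le fun k hk => ?_
      rw [ENNReal.coe_le_coe]
      rcases eq_or_ne k 0 with rfl | hk0
      · simp
      obtain ⟨v, hv, hv0⟩ := ((hSc.hasEigenvalue_iff_mem_spectrum hk0).2 hk).exists_hasEigenvector
      rw [Module.End.mem_eigenspace_iff] at hv
      have hre : ((k.re : ℝ) : ℂ) = k := by
        apply Complex.conj_eq_iff_re.1
        exact hSs.conj_eigenvalue_eq_self
          ((hSc.hasEigenvalue_iff_mem_spectrum hk0).2 hk)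
      have hk0' : k.re ≠ 0 := fun h => hk0 (by rw [← hre, h, Complex.ofReal_zero])
      have hv' : G (v : L) = ((k.re : ℝ) : ℂ) • (v : L) := by
        rw [hre]; exact congrArg Subtype.val hv
      have hvL : (v : L) ≠ 0 := fun h => hv0 (Subtype.ext h)
      have hmem : (v : L) ∈ invEigenspace G c (k.re⁻¹ - c) := by
        rw [mem_invEigenspace, hv', smul_smul, ← Complex.ofReal_mul, sub_add_cancel,
          inv_mul_cancel₀ hk0', Complex.ofReal_one, one_smul]
      have hpos : 0 < k.re := by
        have := pos_of_mem_invEigenspace hG hmem hvL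
        rwa [sub_add_cancel, inv_pos] at this
      have hle : r ≤ k.re⁻¹ - c := by
        by_contra! hlt
        have h1 : (v : L) ∈ spectralBelow G c r :=
          Submodule.mem_iSup_of_mem (p := fun l : Iio r => invEigenspace G c l) ⟨_, hlt⟩ hmem
        exact hvL (inner_self_eq_zero.1 (v.2 _ h1))
      have hkn : ‖k‖ = k.re := by
        rw [← hre, Complex.norm_real, Real.norm_of_nonneg hpos.le, Complex.ofReal_re]
      rw [← NNReal.coe_le_coe, coe_nnnorm, Real.coe_toNNReal _ (inv_nonneg.2 hr.le), hkn,
        le_inv_comm₀ hpos hr]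
      linarith
    have := ENNReal.coe_le_coe.1 hle
    rwa [← NNReal.coe_le_coe, coe_nnnorm, Real.coe_toNNReal _ (inv_nonneg.2 hr.le)] at this
  have h1 : RCLike.re ⟪G u, u⟫_ℂ ≤ ‖G u‖ * ‖u‖ := re_inner_le_norm _ _
  have h2 : ‖G u‖ ≤ (r + c)⁻¹ * ‖u‖ :=
    (S.le_opNorm ⟨u, hu⟩).trans (mul_le_mul_of_nonneg_right hnorm (norm_nonneg _))
  have h3 : (r + c) * ‖G u‖ ≤ ‖u‖ := by
    rwa [← div_eq_inv_mul, le_div_iff₀' hr] at h2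
  nlinarith [norm_nonneg u]

end Spectral

/-! ### Resolvents of coercive forms and comparison of two form domains -/

section Form

variable {K L : Type*} [NormedAddCommGroup K] [InnerProductSpace ℂ K]
  [NormedAddCommGroup L] [InnerProductSpace ℂ L]

/-- `τ f` is the weak solution `p ∈ D` of `⟪φ, A p⟫ = ⟪J φ, f⟫`, `φ ∈ D`. Here `D` is the form
domain, `J` its inclusion in `L`, and `φ ↦ ⟪φ, A φ⟫` the quadratic form, so that `J ∘ τ` is the
inverse of the operator of the form. -/
structure IsFormResolvent (A : K →L[ℂ] K) (J : K →L[ℂ] L) (D : Submodule ℂ K)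
    (τ : L →L[ℂ] K) : Prop where
  mem : ∀ f, τ f ∈ D
  weak : ∀ f, ∀ φ ∈ D, ⟪φ, A (τ f)⟫_ℂ = ⟪J φ, f⟫_ℂ

/-- The Lax–Milgram theorem, for a closed subspace of a complex Hilbert space. -/
theorem exists_isFormResolvent [CompleteSpace K] [CompleteSpace L] (A : K →L[ℂ] K)
    (J : K →L[ℂ] L) (D : Submodule ℂ K) (hD : IsClosed (D : Set K)) {δ : ℝ} (hδ : 0 < δ)
    (hA : ∀ p, δ * ‖p‖ ^ 2 ≤ RCLike.re ⟪p, A p⟫_ℂ) :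
    ∃ τ : L →L[ℂ] K, IsFormResolvent A J D τ := by
  have : CompleteSpace D := hD.completeSpace_coe
  let ι : D →L[ℂ] K := D.subtypeL
  let B : D →L[ℂ] D := (ContinuousLinearMap.adjoint ι) ∘L A ∘L ι
  have hB : ∀ p q : D, ⟪p, B q⟫_ℂ = ⟪(p : K), A q⟫_ℂ := fun p q =>
    ContinuousLinearMap.adjoint_inner_right ι p (A q)
  have hlow : ∀ p : D, δ * ‖p‖ ≤ ‖B p‖ := by
    intro p
    have h1 : δ * ‖p‖ ^ 2 ≤ RCLike.re ⟪p, B p⟫_ℂ := by rw [hB]; exact hA p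
    have h2 : RCLike.re ⟪p, B p⟫_ℂ ≤ ‖p‖ * ‖B p‖ := re_inner_le_norm _ _
    rcases (norm_nonneg p).eq_or_lt with h | h
    · rw [← h, mul_zero]; exact norm_nonneg _
    · exact le_of_mul_le_mul_left (by nlinarith) h
  have hanti : AntilipschitzWith (δ⁻¹).toNNReal B := by
    refine B.antilipschitz_of_bound fun p => ?_
    rw [Real.coe_toNNReal _ (inv_nonneg.2 hδ.le), ← div_eq_inv_mul, le_div_iff₀' hδ]
    exact hlow p
  have hker : B.ker = ⊥ := LinearMap.ker_eq_bot.2 hanti.injective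
  have hran : B.range = ⊤ := by
    have hcl : IsClosed (B.range : Set D) := hanti.isClosed_range B.uniformContinuous
    have := hcl.completeSpace_coe
    rw [← B.range.orthogonal_orthogonal, Submodule.eq_top_iff']
    intro v w hw
    have h1 : ⟪w, B w⟫_ℂ = 0 := inner_eq_zero_symm.1 (hw _ ⟨w, rfl⟩)
    have h2 : δ * ‖w‖ ^ 2 ≤ 0 := by
      have := hA w
      rw [← hB, h1] at this
      simpa using this
    have h3 : w = 0 := by
      have h4 : ‖w‖ ^ 2 ≤ 0 := nonpos_of_mul_nonpos_right h2 hδ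
      exact norm_eq_zero.1 (pow_eq_zero_iff two_ne_zero |>.1 (le_antisymm h4 (sq_nonneg _)))
    rw [h3, inner_zero_left]
  let e : D ≃L[ℂ] D := ContinuousLinearEquiv.ofBijective B hker hran
  refine ⟨ι ∘L (e.symm : D →L[ℂ] D) ∘L (ContinuousLinearMap.adjoint (J ∘L ι)),
    fun f => Subtype.coe_prop _, fun f φ hφ => ?_⟩
  have h1 := hB ⟨φ, hφ⟩ (e.symm (ContinuousLinearMap.adjoint (J ∘L ι) f))
  have h2 : B (e.symm (ContinuousLinearMap.adjoint (J ∘L ι) f))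
      = ContinuousLinearMap.adjoint (J ∘L ι) f := e.apply_symm_apply _
  rw [h2, ContinuousLinearMap.adjoint_inner_right] at h1
  exact h1.symm

variable {A : K →L[ℂ] K} {J : K →L[ℂ] L} {D : Submodule ℂ K} {τ : L →L[ℂ] K}

theorem IsFormResolvent.eq_of_weak (hτ : IsFormResolvent A J D τ) {δ : ℝ} (hδ : 0 < δ)
    (hA : ∀ p, δ * ‖p‖ ^ 2 ≤ RCLike.re ⟪p, A p⟫_ℂ) {p : K} {f : L} (hp : p ∈ D)
    (hw : ∀ φ ∈ D, ⟪φ, A p⟫_ℂ = ⟪J φ, f⟫_ℂ) : p = τ f := by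
  have h1 : ⟪p - τ f, A (p - τ f)⟫_ℂ = 0 := by
    have hm : p - τ f ∈ D := D.sub_mem hp (hτ.mem f)
    rw [map_sub, inner_sub_right, hw _ hm, hτ.weak _ _ hm, sub_self]
  have h2 := hA (p - τ f)
  rw [h1, map_zero] at h2
  have h3 : ‖p - τ f‖ ^ 2 ≤ 0 := nonpos_of_mul_nonpos_right h2 hδ
  exact sub_eq_zero.1 (norm_eq_zero.1
    (pow_eq_zero_iff two_ne_zero |>.1 (le_antisymm h3 (sq_nonneg _))))

theorem IsFormResolvent.isPositive (hτ : IsFormResolvent A J D τ) (hA : A.IsPositive) :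
    (J ∘L τ).IsPositive := by
  refine ⟨fun f g => ?_, fun f => ?_⟩
  · have h1 := hτ.weak g _ (hτ.mem f)
    have h2 := hτ.weak f _ (hτ.mem g)
    have h3 : ⟪f, J (τ g)⟫_ℂ = ⟪A (τ f), τ g⟫_ℂ := by
      rw [← inner_conj_symm, ← h2, inner_conj_symm]
    change ⟪J (τ f), g⟫_ℂ = ⟪f, J (τ g)⟫_ℂ
    rw [← h1, h3, hA.inner_left_eq_inner_right]
  · have h1 := hτ.weak f _ (hτ.mem f)
    change 0 ≤ RCLike.re ⟪J (τ f), f⟫_ℂ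
    rw [← h1]
    exact hA.re_inner_nonneg_right _

/-- The variational lower bound: on the vectors of the form domain orthogonal to the eigenvectors
below `r`, the form is at least `r + c`. The proof optimizes the positive form on the line
`p - t τ (J p)`. -/
theorem IsFormResolvent.le_re_inner [CompleteSpace L] (hτ : IsFormResolvent A J D τ)
    (hA : A.IsPositive) (hJ : IsCompactOperator J) {c r : ℝ} (hr : 0 < r + c) {p : K} (hp : p ∈ D)
    (hperp : J p ∈ (spectralBelow (J ∘L τ) c r)ᗮ) :
    (r + c) * ‖J p‖ ^ 2 ≤ RCLike.re ⟪p, A p⟫_ℂ := by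
  have hG := hτ.isPositive hA
  have h1 := re_inner_le_of_mem_orthogonal hG (hJ.comp_clm τ) hr hperp
  set q := τ (J p) with hq
  have hGq : (J ∘L τ) (J p) = J q := rfl
  rw [hGq] at h1
  have h2 : ⟪p, A q⟫_ℂ = ⟪J p, J p⟫_ℂ := hτ.weak _ _ hp
  have h3 : ⟪q, A q⟫_ℂ = ⟪J q, J p⟫_ℂ := hτ.weak _ _ (hτ.mem _)
  have h4 : ⟪q, A p⟫_ℂ = ⟪J p, J p⟫_ℂ := by
    rw [← hA.inner_left_eq_inner_right, ← inner_conj_symm, h2, inner_conj_symm]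
  have h5 := hA.re_inner_nonneg_right (p - ((r + c : ℝ) : ℂ) • q)
  rw [map_sub, map_smul, inner_sub_left, inner_sub_right, inner_sub_right, inner_smul_left,
    inner_smul_right, inner_smul_right, inner_smul_left, h2, h3, h4, Complex.conj_ofReal,
    ← inner_self_eq_norm_sq (𝕜 := ℂ)] at *
  simp only [map_sub, RCLike.re_to_complex, Complex.re_ofReal_mul] at *
  nlinarith

/-- If the vectors of `D₁` killed by `ψ : K → F` belong to `D₂`, then the number of eigenvalues
below `r` for the form domain `D₁` exceeds the one for `D₂` by at most `dim F`. -/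
theorem finrank_spectralBelow_le [CompleteSpace L] {F : Type*} [AddCommGroup F] [Module ℂ F]
    [FiniteDimensional ℂ F] {D₁ D₂ : Submodule ℂ K} {τ₁ τ₂ : L →L[ℂ] K}
    (hτ₁ : IsFormResolvent A J D₁ τ₁) (hτ₂ : IsFormResolvent A J D₂ τ₂)
    (hA : A.IsPositive) (hJ : IsCompactOperator J) (ψ : K →ₗ[ℂ] F)
    (hψ : ∀ p ∈ D₁, ψ p = 0 → p ∈ D₂) {c r : ℝ} (hr : 0 < r + c) :
    Module.finrank ℂ (spectralBelow (J ∘L τ₁) c r)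
      ≤ Module.finrank ℂ (spectralBelow (J ∘L τ₂) c r) + Module.finrank ℂ F := by
  set W₁ := spectralBelow (J ∘L τ₁) c r
  set W₂ := spectralBelow (J ∘L τ₂) c r with hW₂
  have hG₁ := hτ₁.isPositive hA
  have : FiniteDimensional ℂ W₁ :=
    finiteDimensional_spectralBelow hG₁ (hJ.comp_clm τ₁) hr
  have : FiniteDimensional ℂ W₂ :=
    finiteDimensional_spectralBelow (hτ₂.isPositive hA) (hJ.comp_clm τ₂) hr
  let T : W₁ →ₗ[ℂ] W₂ × F :=
    LinearMap.prod ((W₂.orthogonalProjectionOnto : L →ₗ[ℂ] W₂) ∘ₗ (J : K →ₗ[ℂ] L) ∘ₗ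
      (τ₁ : L →ₗ[ℂ] K) ∘ₗ W₁.subtype) (ψ ∘ₗ (τ₁ : L →ₗ[ℂ] K) ∘ₗ W₁.subtype)
  have hT : Function.Injective T := by
    rw [← LinearMap.ker_eq_bot, LinearMap.ker_eq_bot']
    rintro ⟨f, hf⟩ h
    by_contra hne
    have hf0 : f ≠ 0 := fun h => hne (Subtype.ext h)
    have h1 : W₂.orthogonalProjectionOnto (J (τ₁ f)) = 0 := congrArg Prod.fst h
    have h2 : ψ (τ₁ f) = 0 := congrArg Prod.snd h
    have h3 : J (τ₁ f) ∈ W₂ᗮ :=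
      Submodule.orthogonalProjectionOnto_eq_zero_iff.1 h1
    have h4 := hτ₂.le_re_inner hA hJ hr (hψ _ (hτ₁.mem f) h2) h3
    rw [hτ₁.weak _ _ (hτ₁.mem f)] at h4
    exact absurd (re_inner_lt_of_mem_spectralBelow hG₁ hr hf hf0) (not_lt.2 h4)
  calc Module.finrank ℂ W₁ ≤ Module.finrank ℂ (W₂ × F) :=
        LinearMap.finrank_le_finrank_of_injective hT
    _ = _ := Module.finrank_prod

end Form

/-! ### Absolutely continuous vector-valued functions -/

section AC

variable {E : Type*} [NormedAddCommGroup E] [NormedSpace ℝ E]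

theorem ae_mem_Ioo (a b : ℝ) : ∀ᵐ x ∂(volume.restrict (Icc a b)), x ∈ Ioo a b := by
  rw [← restrict_Ioo_eq_restrict_Icc]
  exact ae_restrict_mem measurableSet_Ioo

/-- The primitive of an integrable vector-valued function `h` is absolutely continuous, since its
increments are dominated by those of the primitive of `‖h‖`. -/
theorem absolutelyContinuousOnInterval_primitive {a b : ℝ} {h : ℝ → E}
    (hh : IntervalIntegrable h volume a b) :
    AbsolutelyContinuousOnInterval (fun x => ∫ t in a..x, h t) a b := by
  have hn := hh.norm.absolutelyContinuousOnInterval_intervalIntegral (c := a) left_mem_uIcc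
  rw [absolutelyContinuousOnInterval_iff] at hn ⊢
  intro ε hε
  obtain ⟨δ, hδ, H⟩ := hn ε hε
  refine ⟨δ, hδ, fun I hI hlt => lt_of_le_of_lt (Finset.sum_le_sum fun i hi => ?_) (H I hI hlt)⟩
  have hm := hI.1 i hi
  have hint : ∀ x ∈ uIcc a b, IntervalIntegrable h volume a x := fun x hx =>
    hh.mono_set (uIcc_subset_uIcc_left hx)
  rw [dist_comm, dist_comm (∫ t in a..(I.2 i).1, ‖h t‖), dist_eq_norm, dist_eq_norm,
    intervalIntegral.integral_interval_sub_left (hint _ hm.2) (hint _ hm.1),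
    intervalIntegral.integral_interval_sub_left (hint _ hm.2).norm (hint _ hm.1).norm]
  exact intervalIntegral.norm_integral_le_abs_integral_norm

theorem absolutelyContinuousOnInterval_const_add_primitive {a b : ℝ} {h : ℝ → E} (k : E)
    (hh : IntervalIntegrable h volume a b) :
    AbsolutelyContinuousOnInterval (fun x => k + ∫ t in a..x, h t) a b :=
  AbsolutelyContinuousOnInterval.fun_add
    ((LipschitzWith.const k).lipschitzOnWith).absolutelyContinuousOnInterval
    (absolutelyContinuousOnInterval_primitive hh)

/-- The fundamental theorem of calculus for absolutely continuous vector-valued functions. -/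
theorem eq_add_integral_of_absolutelyContinuous [CompleteSpace E] {a b : ℝ} (hab : a ≤ b)
    {f h : ℝ → E} (hf : AbsolutelyContinuousOnInterval f a b)
    (hh : IntervalIntegrable h volume a b)
    (hd : ∀ᵐ x ∂(volume.restrict (Icc a b)), HasDerivAt f (h x) x) :
    ∀ x ∈ Icc a b, f x = f a + ∫ t in a..x, h t := by
  have hg := hf.fun_sub (absolutelyContinuousOnInterval_primitive hh)
  obtain ⟨C, hC⟩ := hg.const_of_ae_hasDerivAt_zero (by
    rw [ae_restrict_iff' measurableSet_Icc] at hd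
    filter_upwards [hd, hh.ae_hasDerivAt_integral] with x h1 h2 hx
    have h3 := (h1 (by rwa [uIcc_of_le hab] at hx)).sub (h2 hx a left_mem_uIcc)
    rwa [sub_self] at h3)
  rw [uIcc_of_le hab] at hC
  intro x hx
  have h1 := hC x hx
  have h2 := hC a (left_mem_Icc.2 hab)
  simp only [intervalIntegral.integral_same, sub_zero] at h2
  rw [h2, ← h1, sub_add_cancel]

end AC

/-! ### Integration on `L²([a,b], ℂⁿ)` -/

section Primitive

variable {n : ℕ} {a b : ℝ}

theorem integrable_coe (u : L2 n a b) : Integrable u (volume.restrict (Icc a b)) :=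
  (Lp.memLp u).integrable one_le_two

theorem intervalIntegrable_of_integrable {h : ℝ → Cn n} (hab : a ≤ b)
    (hh : Integrable h (volume.restrict (Icc a b))) : IntervalIntegrable h volume a b := by
  rw [intervalIntegrable_iff_integrableOn_Icc_of_le hab]
  exact hh

theorem intervalIntegrable_coe (hab : a ≤ b) (u : L2 n a b) : IntervalIntegrable u volume a b :=
  intervalIntegrable_of_integrable hab (integrable_coe u)

/-- The Cauchy–Schwarz bound for the increments of the primitive of an `L²` function. -/
theorem norm_integral_le_sqrt_mul {x y : ℝ} (hx : x ∈ Icc a b) (hy : y ∈ Icc a b)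
    (u : L2 n a b) : ‖∫ t in x..y, u t‖ ≤ √|y - x| * ‖u‖ := by
  wlog hxy : x ≤ y generalizing x y
  · rw [intervalIntegral.integral_symm, norm_neg, abs_sub_comm]
    exact this hy hx (le_of_not_ge hxy)
  rw [intervalIntegral.integral_of_le hxy]
  have hsub : Ioc x y ⊆ Icc a b := fun t ht => ⟨hx.1.trans ht.1.le, ht.2.trans hy.2⟩
  have hres : (volume.restrict (Icc a b)).restrict (Ioc x y) = volume.restrict (Ioc x y) :=
    Measure.restrict_restrict_of_subset hsub
  have hvol : (volume.restrict (Icc a b)) (Ioc x y) = ENNReal.ofReal (y - x) := by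
    rw [Measure.restrict_apply measurableSet_Ioc, inter_eq_left.2 hsub, Real.volume_Ioc]
  set v : Cn n := ∫ t in Ioc x y, u t with hv
  have hfin : (volume.restrict (Icc a b)) (Ioc x y) ≠ ⊤ := by rw [hvol]; exact ENNReal.ofReal_ne_top
  have h1 := L2.inner_indicatorConstLp_eq_inner_setIntegral ℂ measurableSet_Ioc hfin v u
  rw [hres] at h1
  have h2 : ‖v‖ ^ 2 ≤ (√|y - x| * ‖v‖) * ‖u‖ := by
    calc ‖v‖ ^ 2 = RCLike.re ⟪v, v⟫_ℂ := (inner_self_eq_norm_sq v).symm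
      _ = RCLike.re ⟪indicatorConstLp 2 measurableSet_Ioc hfin v, u⟫_ℂ := by rw [h1]
      _ ≤ ‖indicatorConstLp 2 measurableSet_Ioc hfin v‖ * ‖u‖ := re_inner_le_norm _ _
      _ = _ := by
        rw [norm_indicatorConstLp two_ne_zero ENNReal.ofNat_ne_top, Measure.real, hvol,
          ENNReal.toReal_ofReal (sub_nonneg.2 hxy), abs_of_nonneg (sub_nonneg.2 hxy),
          Real.sqrt_eq_rpow, mul_comm ‖v‖]
        norm_num
  rcases (norm_nonneg v).eq_or_lt with h | h
  · rw [← h]; positivity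
  · nlinarith

/-- The embedding of the constant functions. -/
def constL (n : ℕ) (a b : ℝ) : Cn n →L[ℂ] L2 n a b :=
  Lp.constL 2 (volume.restrict (Icc a b)) ℂ

theorem coeFn_constL (d : Cn n) : ∀ᵐ x ∂(volume.restrict (Icc a b)), constL n a b d x = d :=
  Lp.coeFn_const 2 (volume.restrict (Icc a b)) d

/-- The integral over `[a,b]`, defined as the adjoint of the embedding of the constants. -/
def intL (n : ℕ) (a b : ℝ) : L2 n a b →L[ℂ] Cn n :=
  ContinuousLinearMap.adjoint (constL n a b)

theorem intL_apply (u : L2 n a b) : intL n a b u = ∫ x in Icc a b, u x := by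
  refine ext_inner_left ℂ fun d => ?_
  rw [intL, ContinuousLinearMap.adjoint_inner_right, L2.inner_def,
    ← integral_inner (integrable_coe u)]
  refine integral_congr_ae ?_
  filter_upwards [coeFn_constL (a := a) (b := b) d] with x hx
  rw [hx]

theorem intL_eq_of_ae (hab : a ≤ b) {u : L2 n a b} {h : ℝ → Cn n}
    (hu : ∀ᵐ x ∂(volume.restrict (Icc a b)), u x = h x) : intL n a b u = ∫ x in a..b, h x := by
  rw [intL_apply, intervalIntegral.integral_of_le hab, ← integral_Icc_eq_integral_Ioc]
  exact integral_congr_ae hu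

theorem inner_constL_left (d : Cn n) (u : L2 n a b) :
    ⟪constL n a b d, u⟫_ℂ = ⟪d, intL n a b u⟫_ℂ :=
  (ContinuousLinearMap.adjoint_inner_right _ _ _).symm

theorem inner_constL_right (d : Cn n) (u : L2 n a b) :
    ⟪u, constL n a b d⟫_ℂ = ⟪intL n a b u, d⟫_ℂ :=
  (ContinuousLinearMap.adjoint_inner_left _ _ _).symm

theorem intL_constL (hab : a ≤ b) (d : Cn n) :
    intL n a b (constL n a b d) = ((b - a : ℝ) : ℂ) • d := by
  rw [intL_eq_of_ae hab (coeFn_constL d), intervalIntegral.integral_const]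
  exact (Complex.coe_smul _ _).symm

theorem integral_congr_of_ae {u h : ℝ → Cn n}
    (hu : ∀ᵐ x ∂(volume.restrict (Icc a b)), u x = h x) {x : ℝ} (hx : x ∈ Icc a b) :
    ∫ t in a..x, u t = ∫ t in a..x, h t := by
  refine intervalIntegral.integral_congr_ae ?_
  rw [ae_restrict_iff' measurableSet_Icc] at hu
  filter_upwards [hu] with t ht h1
  rw [uIoc_of_le hx.1] at h1
  exact ht ⟨h1.1.le, h1.2.trans hx.2⟩

theorem continuousOn_primitive {h : ℝ → Cn n} (hh : Integrable h (volume.restrict (Icc a b))) :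
    ContinuousOn (fun x => ∫ t in a..x, h t) (Icc a b) := by
  rcases le_or_gt a b with hab | hab
  · have := intervalIntegral.continuousOn_primitive_interval (a := a) (b := b) (f := h)
      (μ := volume) (by rw [uIcc_of_le hab]; exact hh)
    rwa [uIcc_of_le hab] at this
  · rw [Icc_eq_empty hab.not_ge]
    exact continuousOn_empty _

theorem memLp_of_continuousOn {f : ℝ → Cn n} (hf : ContinuousOn f (Icc a b)) :
    MemLp f 2 (volume.restrict (Icc a b)) := by
  obtain ⟨C, hC⟩ := isCompact_Icc.exists_bound_of_continuousOn hf
  refine MemLp.of_bound (hf.aestronglyMeasurable measurableSet_Icc) C ?_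
  filter_upwards [ae_restrict_mem measurableSet_Icc] with x hx using hC x hx

theorem memLp_primitive (u : L2 n a b) :
    MemLp (fun x => ∫ t in a..x, u t) 2 (volume.restrict (Icc a b)) :=
  memLp_of_continuousOn (continuousOn_primitive (integrable_coe u))

theorem primitive_add (u v : L2 n a b) {x : ℝ} (hx : x ∈ Icc a b) :
    ∫ t in a..x, (u + v) t = (∫ t in a..x, u t) + ∫ t in a..x, v t := by
  have hab := hx.1.trans hx.2
  have hx' : x ∈ uIcc a b := by rwa [uIcc_of_le hab]
  rw [integral_congr_of_ae (Lp.coeFn_add u v) hx]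
  exact intervalIntegral.integral_add
    ((intervalIntegrable_coe hab u).mono_set (uIcc_subset_uIcc_left hx'))
    ((intervalIntegrable_coe hab v).mono_set (uIcc_subset_uIcc_left hx'))

theorem primitive_smul (c : ℂ) (u : L2 n a b) {x : ℝ} (hx : x ∈ Icc a b) :
    ∫ t in a..x, (c • u) t = c • ∫ t in a..x, u t := by
  rw [integral_congr_of_ae (Lp.coeFn_smul c u) hx]
  exact intervalIntegral.integral_smul c _

/-- The primitive `u ↦ ∫ₐˣ u`, as an operator in `L²([a,b], ℂⁿ)`. -/
def primL (n : ℕ) (a b : ℝ) : L2 n a b →L[ℂ] L2 n a b :=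
  LinearMap.mkContinuous
    { toFun := fun u => (memLp_primitive u).toLp _
      map_add' := fun u v => by
        refine Lp.ext ?_
        filter_upwards [(memLp_primitive (u + v)).coeFn_toLp, (memLp_primitive u).coeFn_toLp,
          (memLp_primitive v).coeFn_toLp, ae_restrict_mem measurableSet_Icc,
          Lp.coeFn_add ((memLp_primitive u).toLp _) ((memLp_primitive v).toLp _)]
          with x h1 h2 h3 h4 h5
        rw [h1, h5, Pi.add_apply, h2, h3, primitive_add u v h4]
      map_smul' := fun c u => by
        refine Lp.ext ?_
        filter_upwards [(memLp_primitive (c • u)).coeFn_toLp, (memLp_primitive u).coeFn_toLp,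
          ae_restrict_mem measurableSet_Icc, Lp.coeFn_smul c ((memLp_primitive u).toLp _)]
          with x h1 h2 h3 h4
        rw [h1, RingHom.id_apply, h4, Pi.smul_apply, h2, primitive_smul c u h3] }
    ((measureUnivNNReal (volume.restrict (Icc a b)) : ℝ) ^ (2 : ENNReal).toReal⁻¹ * √(b - a))
    fun u => by
      rw [mul_assoc]
      refine Lp.norm_le_of_ae_bound (by positivity) ?_
      filter_upwards [(memLp_primitive u).coeFn_toLp, ae_restrict_mem measurableSet_Icc]
        with x h1 h2
      have hab := h2.1.trans h2.2
      change ‖((memLp_primitive u).toLp _ : L2 n a b) x‖ ≤ _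
      rw [h1]
      refine (norm_integral_le_sqrt_mul (left_mem_Icc.2 hab) h2 u).trans ?_
      gcongr
      rw [abs_of_nonneg (sub_nonneg.2 h2.1)]
      linarith [h2.2]

theorem coeFn_primL (u : L2 n a b) :
    ∀ᵐ x ∂(volume.restrict (Icc a b)), primL n a b u x = ∫ t in a..x, u t :=
  (memLp_primitive u).coeFn_toLp

/-- By the Arzelà–Ascoli theorem: the primitives of the functions in the unit ball are bounded and
equicontinuous. -/
theorem isCompactOperator_primL (hab : a ≤ b) : IsCompactOperator (primL n a b) := by
  have hcont (u : L2 n a b) : Continuous fun x : Icc a b => ∫ t in a..(x : ℝ), u t :=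
    continuousOn_iff_continuous_domRestrict.1 (continuousOn_primitive (integrable_coe u))
  let P (u : L2 n a b) : BoundedContinuousFunction (Icc a b) (Cn n) :=
    BoundedContinuousFunction.mkOfCompact ⟨_, hcont u⟩
  let A : Set (BoundedContinuousFunction (Icc a b) (Cn n)) := P '' Metric.closedBall 0 1
  have hA : IsCompact (closure A) := by
    refine BoundedContinuousFunction.arzela_ascoli (Metric.closedBall 0 √(b - a))
      (isCompact_closedBall _ _) A ?_ ?_
    · rintro _ x ⟨u, hu, rfl⟩
      rw [mem_closedBall_zero_iff] at hu ⊢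
      refine (norm_integral_le_sqrt_mul (left_mem_Icc.2 hab) x.2 u).trans ?_
      calc √|(x : ℝ) - a| * ‖u‖ ≤ √(b - a) * 1 := by
            gcongr
            rw [abs_of_nonneg (sub_nonneg.2 x.2.1)]
            linarith [x.2.2]
        _ = √(b - a) := mul_one _
    · refine Metric.equicontinuous_of_continuity_modulus (fun t => √t) ?_ _ ?_
      · have := Real.continuous_sqrt.tendsto 0
        rwa [Real.sqrt_zero] at this
      · rintro x y ⟨_, u, hu, rfl⟩
        rw [mem_closedBall_zero_iff] at hu
        have hx : (x : ℝ) ∈ uIcc a b := by rw [uIcc_of_le hab]; exact x.2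
        have hy : (y : ℝ) ∈ uIcc a b := by rw [uIcc_of_le hab]; exact y.2
        have hi := intervalIntegrable_coe hab u
        change dist (∫ t in a..(x : ℝ), u t) (∫ t in a..(y : ℝ), u t) ≤ _
        rw [dist_eq_norm, intervalIntegral.integral_interval_sub_left
          (hi.mono_set (uIcc_subset_uIcc_left hx)) (hi.mono_set (uIcc_subset_uIcc_left hy))]
        refine (norm_integral_le_sqrt_mul y.2 x.2 u).trans ?_
        rw [Subtype.dist_eq, Real.dist_eq]
        exact mul_le_of_le_one_right (Real.sqrt_nonneg _) hu
  let e : C(ℝ, Icc a b) := ⟨projIcc a b hab, continuous_projIcc⟩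
  let Φ : BoundedContinuousFunction (Icc a b) (Cn n) → L2 n a b := fun F =>
    BoundedContinuousFunction.toLp 2 (volume.restrict (Icc a b)) ℂ (F.compContinuous e)
  have hΦ : Continuous Φ := (ContinuousLinearMap.continuous _).comp
    (BoundedContinuousFunction.continuous_compContinuous e)
  have hΦP : ∀ u, Φ (P u) = primL n a b u := by
    intro u
    refine Lp.ext ?_
    filter_upwards [coeFn_primL u, ae_restrict_mem measurableSet_Icc,
      BoundedContinuousFunction.coeFn_toLp 2 (volume.restrict (Icc a b)) ℂ
        ((P u).compContinuous e)] with x h1 h2 h3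
    rw [h1, h3]
    change ∫ t in a..(projIcc a b hab x : ℝ), u t = _
    rw [projIcc_of_mem hab h2]
  refine (isCompactOperator_iff_image_closedBall_subset_compact (primL n a b : L2 n a b →ₗ[ℂ] _)
    one_pos).2 ⟨Φ '' closure A, hA.image hΦ, ?_⟩
  rintro _ ⟨u, hu, rfl⟩
  exact ⟨P u, subset_closure ⟨u, hu, rfl⟩, hΦP u⟩

/-- Integration by parts. Both sides are continuous, so that it suffices to treat continuous
functions. -/
theorem inner_primL_add (hab : a ≤ b) (u v : L2 n a b) :
    ⟪primL n a b u, v⟫_ℂ + ⟪u, primL n a b v⟫_ℂ = ⟪intL n a b u, intL n a b v⟫_ℂ := by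
  refine DenseRange.induction_on₂ (BoundedContinuousFunction.toLp_denseRange (E := Cn n) (p := 2)
    (μ := volume.restrict (Icc a b)) ℂ ENNReal.ofNat_ne_top) ?_ ?_ u v
  · exact isClosed_eq (by fun_prop) (by fun_prop)
  intro f g
  have hf := BoundedContinuousFunction.coeFn_toLp 2 (volume.restrict (Icc a b)) ℂ f
  have hg := BoundedContinuousFunction.coeFn_toLp 2 (volume.restrict (Icc a b)) ℂ g
  set F := BoundedContinuousFunction.toLp 2 (volume.restrict (Icc a b)) ℂ f
  set G := BoundedContinuousFunction.toLp 2 (volume.restrict (Icc a b)) ℂ g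
  have hdf (x : ℝ) : HasDerivAt (fun x => ∫ t in a..x, f t) (f x) x :=
    f.continuous.integral_hasStrictDerivAt a x |>.hasDerivAt
  have hdg (x : ℝ) : HasDerivAt (fun x => ∫ t in a..x, g t) (g x) x :=
    g.continuous.integral_hasStrictDerivAt a x |>.hasDerivAt
  have hcf : Continuous fun x => ∫ t in a..x, f t :=
    continuous_iff_continuousAt.2 fun x => (hdf x).continuousAt
  have hcg : Continuous fun x => ∫ t in a..x, g t :=
    continuous_iff_continuousAt.2 fun x => (hdg x).continuousAt
  have hc : Continuous fun x => ⟪∫ t in a..x, f t, g x⟫_ℂ + ⟪f x, ∫ t in a..x, g t⟫_ℂ :=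
    (hcf.inner g.continuous).add (f.continuous.inner hcg)
  have hftc := intervalIntegral.integral_eq_sub_of_hasDerivAt
    (fun x _ => (hdf x).inner ℂ (hdg x)) (hc.intervalIntegrable a b)
  rw [intervalIntegral.integral_same, inner_zero_left, sub_zero] at hftc
  rw [intL_eq_of_ae hab hf, intL_eq_of_ae hab hg, ← hftc, L2.inner_def, L2.inner_def,
    ← integral_add (L2.integrable_inner _ _) (L2.integrable_inner _ _),
    intervalIntegral.integral_of_le hab, ← integral_Icc_eq_integral_Ioc]
  refine integral_congr_ae ?_
  filter_upwards [hf, hg, coeFn_primL F, coeFn_primL G, ae_restrict_mem measurableSet_Icc]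
    with x h1 h2 h3 h4 h5
  rw [h1, h2, h3, h4, integral_congr_of_ae hf h5, integral_congr_of_ae hg h5]

end Primitive

/-! ### The Laplacian in terms of primitives -/

section Laplacian

variable {n : ℕ} {a b : ℝ}

/-- The quasi-periodicity factor minus one: `f(b) = e^{iθ} f(a)` says that the increment of `f` is
this multiple of `f(a)`. -/
def twist (θ : ℝ) : ℂ := Complex.exp (Complex.I * θ) - 1

theorem conj_twist_mul (θ : ℝ) :
    (starRingEnd ℂ) (twist θ) + twist θ + (starRingEnd ℂ) (twist θ) * twist θ = 0 := by
  have h : (starRingEnd ℂ) (Complex.exp (Complex.I * θ)) * Complex.exp (Complex.I * θ) = 1 := by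
    rw [← Complex.exp_conj, map_mul, Complex.conj_I, Complex.conj_ofReal, ← Complex.exp_add]
    simp
  rw [twist, map_sub, map_one]
  linear_combination h

/-- `w = -u''`, with quasi-periodic boundary conditions, expressed with primitives: `d = u(a)`,
`g = u'`, and `k = u'(a)`. -/
theorem mem_laplacianGraph_iff (hab : a < b) {θ : ℝ} {u w : L2 n a b} :
    (u, w) ∈ laplacianGraph n a b θ ↔ ∃ (d k : Cn n) (g : L2 n a b),
      u = constL n a b d + primL n a b g ∧ g = constL n a b k - primL n a b w ∧
      intL n a b g = twist θ • d ∧ -intL n a b w = twist θ • k := by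
  have hle := hab.le
  constructor
  · rintro ⟨f, g, h⟩
    have hwi : Integrable (fun x => -w x) (volume.restrict (Icc a b)) := (integrable_coe w).neg
    have hg := eq_add_integral_of_absolutelyContinuous hle h.ac'
      (intervalIntegrable_of_integrable hle hwi) h.deriv'
    have hgc : ContinuousOn g (Icc a b) := by
      have := h.ac'.continuousOn
      rwa [uIcc_of_le hle] at this
    have hgm := memLp_of_continuousOn hgc
    have hf := eq_add_integral_of_absolutelyContinuous hle h.ac
      (intervalIntegrable_of_integrable hle (hgm.integrable one_le_two)) (by
        filter_upwards [ae_mem_Ioo a b] with x hx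
        exact (h.deriv x (Ioo_subset_Icc_self hx)).hasDerivAt (Icc_mem_nhds hx.1 hx.2))
    have hG := hgm.coeFn_toLp
    have hb := right_mem_Icc.2 hle
    refine ⟨f a, g a, hgm.toLp g, ?_, ?_, ?_, ?_⟩
    · refine Lp.ext ?_
      filter_upwards [h.rep, coeFn_constL (a := a) (b := b) (f a), coeFn_primL (hgm.toLp g),
        Lp.coeFn_add (constL n a b (f a)) (primL n a b (hgm.toLp g)),
        ae_restrict_mem measurableSet_Icc] with x h1 h2 h3 h4 h5
      rw [h1, h4, Pi.add_apply, h2, h3, hf x h5, integral_congr_of_ae hG h5]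
    · refine Lp.ext ?_
      filter_upwards [hG, coeFn_constL (a := a) (b := b) (g a), coeFn_primL w,
        Lp.coeFn_sub (constL n a b (g a)) (primL n a b w),
        ae_restrict_mem measurableSet_Icc] with x h1 h2 h3 h4 h5
      rw [h1, h4, Pi.sub_apply, h2, h3, hg x h5, intervalIntegral.integral_neg, sub_eq_add_neg]
    · rw [intL_eq_of_ae hle hG, twist, sub_smul, one_smul, ← h.bc, hf b hb, add_sub_cancel_left]
    · rw [intL_eq_of_ae hle (Filter.Eventually.of_forall fun _ => rfl), twist, sub_smul, one_smul,
        ← h.bc', hg b hb, add_sub_cancel_left, intervalIntegral.integral_neg]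
  · rintro ⟨d, k, g, hu, hg, hgi, hwi⟩
    have hwint : IntervalIntegrable (fun x => -w x) volume a b := (intervalIntegrable_coe hle w).neg
    set G : ℝ → Cn n := fun x => k + ∫ t in a..x, -w t with hG
    have hGac : AbsolutelyContinuousOnInterval G a b :=
      absolutelyContinuousOnInterval_const_add_primitive k hwint
    have hGc : ContinuousOn G (Icc a b) := by
      have := hGac.continuousOn
      rwa [uIcc_of_le hle] at this
    have hGint : IntervalIntegrable G volume a b :=
      (hGc.mono (uIcc_of_le hle).subset).intervalIntegrable
    have hgG : ∀ᵐ x ∂(volume.restrict (Icc a b)), g x = G x := by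
      rw [hg]
      filter_upwards [coeFn_constL (a := a) (b := b) k, coeFn_primL w,
        Lp.coeFn_sub (constL n a b k) (primL n a b w)] with x h2 h3 h4
      rw [h4, Pi.sub_apply, h2, h3, hG]
      simp only [intervalIntegral.integral_neg, sub_eq_add_neg]
    refine ⟨fun x => d + ∫ t in a..x, G t, G, ?_, ?_, hGac, ?_, ?_, ?_, ?_⟩
    · rw [hu]
      filter_upwards [coeFn_constL (a := a) (b := b) d, coeFn_primL g,
        Lp.coeFn_add (constL n a b d) (primL n a b g), ae_restrict_mem measurableSet_Icc]
        with x h2 h3 h4 h5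
      rw [h4, Pi.add_apply, h2, h3, integral_congr_of_ae hgG h5]
    · exact absolutelyContinuousOnInterval_const_add_primitive d hGint
    · intro x hx
      have : Fact (x ∈ Icc a b) := ⟨hx⟩
      refine HasDerivWithinAt.const_add d (intervalIntegral.integral_hasDerivWithinAt_right
        (hGint.mono_set (uIcc_subset_uIcc_left (by rwa [uIcc_of_le hle])))
        (t := Icc a b) ?_ (hGc x hx))
      exact hGc.stronglyMeasurableAtFilter_nhdsWithin measurableSet_Icc x
    · rw [ae_restrict_iff' measurableSet_Icc]
      filter_upwards [hwint.ae_hasDerivAt_integral] with x h1 hx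
      exact (h1 (by rwa [uIcc_of_le hle]) a left_mem_uIcc).const_add k
    · rw [intL_eq_of_ae hle hgG, twist, sub_smul, one_smul] at hgi
      simp only [intervalIntegral.integral_same, add_zero, hgi]
      abel
    · rw [intL_eq_of_ae hle (Filter.Eventually.of_forall fun _ => rfl),
        ← intervalIntegral.integral_neg, twist, sub_smul, one_smul] at hwi
      simp only [hG, intervalIntegral.integral_same, add_zero, hwi]
      abel

/-- The space of the pairs `(u', u(a))`, which parametrizes the Sobolev space `H¹([a,b], ℂⁿ)`. -/
abbrev H1 (n : ℕ) (a b : ℝ) : Type := WithLp 2 (L2 n a b × Cn n)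

/-- The embedding of `H¹` in `L²`, which recovers `u` from `(u', u(a))`. -/
def embL (n : ℕ) (a b : ℝ) : H1 n a b →L[ℂ] L2 n a b :=
  constL n a b ∘L WithLp.sndL 2 ℂ (L2 n a b) (Cn n)
    + primL n a b ∘L WithLp.fstL 2 ℂ (L2 n a b) (Cn n)

theorem embL_apply (p : H1 n a b) : embL n a b p = constL n a b p.snd + primL n a b p.fst := rfl

theorem isCompactOperator_embL (hab : a ≤ b) : IsCompactOperator (embL n a b) := by
  have h1 : IsCompactOperator (WithLp.sndL 2 ℂ (L2 n a b) (Cn n)) :=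
    isCompactOperator_of_locallyCompactSpace_dom _
  exact (h1.clm_comp (constL n a b)).add
    ((isCompactOperator_primL hab).comp_clm (WithLp.fstL 2 ℂ (L2 n a b) (Cn n)))

/-- The form domain of the quasi-periodic Laplacian: the condition `u(b) = e^{iθ} u(a)`. -/
def formDomain (n : ℕ) (a b θ : ℝ) : Submodule ℂ (H1 n a b) :=
  LinearMap.ker (intL n a b ∘L WithLp.fstL 2 ℂ (L2 n a b) (Cn n)
    - twist θ • WithLp.sndL 2 ℂ (L2 n a b) (Cn n)).toLinearMap

theorem mem_formDomain {θ : ℝ} {p : H1 n a b} :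
    p ∈ formDomain n a b θ ↔ intL n a b p.fst = twist θ • p.snd := by
  rw [← sub_eq_zero]
  exact LinearMap.mem_ker

theorem isClosed_formDomain (θ : ℝ) : IsClosed (formDomain n a b θ : Set (H1 n a b)) :=
  ContinuousLinearMap.isClosed_ker _

/-- The weak formulation of `w = -u''` with the quasi-periodic boundary conditions. The condition on
`u'` is the natural boundary condition of the form. -/
theorem mem_laplacianGraph_iff_weak (hab : a < b) {θ : ℝ} {u w : L2 n a b} :
    (u, w) ∈ laplacianGraph n a b θ ↔ ∃ p ∈ formDomain n a b θ, embL n a b p = u ∧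
      ∀ φ ∈ formDomain n a b θ, ⟪φ.fst, p.fst⟫_ℂ = ⟪embL n a b φ, w⟫_ℂ := by
  have hle := hab.le
  have hemb (φ : H1 n a b) : ⟪embL n a b φ, w⟫_ℂ = ⟪φ.snd, intL n a b w⟫_ℂ
      + ⟪intL n a b φ.fst, intL n a b w⟫_ℂ - ⟪φ.fst, primL n a b w⟫_ℂ := by
    rw [embL_apply, inner_add_left, inner_constL_left, ← inner_primL_add hle]
    ring
  rw [mem_laplacianGraph_iff hab]
  constructor
  · rintro ⟨d, k, g, hu, hg, hgi, hwi⟩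
    refine ⟨WithLp.toLp 2 (g, d), mem_formDomain.2 hgi, hu.symm, fun φ hφ => ?_⟩
    rw [mem_formDomain] at hφ
    have hwi' : intL n a b w = -(twist θ • k) := by rw [← hwi, neg_neg]
    change ⟪φ.fst, g⟫_ℂ = _
    rw [hemb, hg, inner_sub_right, inner_constL_right, hφ, hwi', inner_neg_right, inner_neg_right,
      inner_smul_left, inner_smul_left, inner_smul_right]
    linear_combination ⟪φ.snd, k⟫_ℂ * conj_twist_mul θ
  · rintro ⟨p, hp, hpu, hweak⟩
    rw [mem_formDomain] at hp
    have hL : ((b - a : ℝ) : ℂ) ≠ 0 := Complex.ofReal_ne_zero.2 (sub_pos.2 hab).ne'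
    set y := p.fst + primL n a b w with hy
    -- The mean value of `u' + ∫ w` is the value of `u'` at `a`.
    set k := (((b - a : ℝ) : ℂ)⁻¹) • intL n a b y with hk
    have hyk : intL n a b (y - constL n a b k) = 0 := by
      rw [map_sub, intL_constL hle, hk, smul_smul, mul_inv_cancel₀ hL, one_smul, sub_self]
    have hzero : y - constL n a b k = 0 := by
      have h1 := hweak (WithLp.toLp 2 (y - constL n a b k, 0))
        (mem_formDomain.2 (hyk.trans (smul_zero _).symm))
      rw [hemb] at h1
      change ⟪y - constL n a b k, p.fst⟫_ℂ = ⟪(0 : Cn n), _⟫_ℂ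
        + ⟪intL n a b (y - constL n a b k), _⟫_ℂ - ⟪y - constL n a b k, _⟫_ℂ at h1
      rw [hyk, inner_zero_left, add_zero, zero_sub] at h1
      have h2 : ⟪y - constL n a b k, y⟫_ℂ = 0 := by
        nth_rewrite 2 [hy]
        rw [inner_add_right, h1, neg_add_cancel]
      rw [← inner_self_eq_zero (𝕜 := ℂ), inner_sub_right, h2, inner_constL_right, hyk,
        inner_zero_left, sub_zero]
    have hgk : p.fst = constL n a b k - primL n a b w := by
      rw [← sub_eq_zero.1 hzero, hy, add_sub_cancel_right]
    refine ⟨p.snd, k, p.fst, hpu.symm, hgk, hp, ?_⟩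
    refine ext_inner_left ℂ fun e => ?_
    -- The test function with constant derivative whose value at `a` is `e`.
    have hmem : (WithLp.toLp 2 (constL n a b (((b - a : ℝ) : ℂ)⁻¹ • twist θ • e), e) : H1 n a b)
        ∈ formDomain n a b θ := by
      rw [mem_formDomain]
      change intL n a b (constL n a b _) = twist θ • e
      rw [intL_constL hle, smul_smul, mul_inv_cancel₀ hL, one_smul]
    have h1 := hweak _ hmem
    rw [hemb] at h1
    have hi := mem_formDomain.1 hmem
    rw [hi] at h1
    change ⟪constL n a b (((b - a : ℝ) : ℂ)⁻¹ • twist θ • e), p.fst⟫_ℂ = ⟪e, _⟫_ℂ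
      + ⟪twist θ • e, _⟫_ℂ - ⟪constL n a b (((b - a : ℝ) : ℂ)⁻¹ • twist θ • e), _⟫_ℂ at h1
    rw [hgk, inner_sub_right, inner_constL_left, intL_constL hle, inner_smul_left, inner_smul_right,
      map_inv₀, Complex.conj_ofReal, ← mul_assoc, inv_mul_cancel₀ hL, one_mul, inner_smul_left,
      inner_smul_left] at h1
    have h2 : (starRingEnd ℂ) (twist θ) * ⟪e, k⟫_ℂ
        = (1 + (starRingEnd ℂ) (twist θ)) * ⟪e, intL n a b w⟫_ℂ := by
      linear_combination h1
    rw [inner_neg_right, inner_smul_right]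
    linear_combination (1 + twist θ) * h2
      - (⟪e, k⟫_ℂ - ⟪e, intL n a b w⟫_ℂ) * conj_twist_mul θ

end Laplacian

/-! ### Multiplication by the potential -/

section Potential

variable {n : ℕ} {a b : ℝ}

theorem norm_matAct_le (M : Matrix (Fin n) (Fin n) ℝ) (z : Cn n) :
    ‖matAct M z‖ ≤ (∑ i, ∑ j, |M i j|) * ‖z‖ := by
  rw [← (EuclideanSpace.basisFun (Fin n) ℂ).sum_repr (matAct M z), Finset.sum_mul]
  refine (norm_sum_le _ _).trans (Finset.sum_le_sum fun i _ => ?_)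
  rw [norm_smul, OrthonormalBasis.norm_eq_one, mul_one, EuclideanSpace.basisFun_repr,
    Finset.sum_mul]
  change ‖∑ j, (M i j : ℂ) * z j‖ ≤ _
  refine (norm_sum_le _ _).trans (Finset.sum_le_sum fun j _ => ?_)
  rw [norm_mul, Complex.norm_real, Real.norm_eq_abs]
  exact mul_le_mul_of_nonneg_left (PiLp.norm_apply_le z j) (abs_nonneg _)

theorem inner_matAct_left {M : Matrix (Fin n) (Fin n) ℝ} (hM : M.IsSymm) (z w : Cn n) :
    ⟪matAct M z, w⟫_ℂ = ⟪z, matAct M w⟫_ℂ := by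
  have hH : (M.map (fun t : ℝ => (t : ℂ))).IsHermitian := by
    refine Matrix.IsHermitian.ext fun i j => ?_
    rw [Matrix.map_apply, Matrix.map_apply, Complex.star_def, Complex.conj_ofReal, hM.apply]
  exact Matrix.isSymmetric_toEuclideanLin_iff.2 hH z w

theorem matAct_add (M : Matrix (Fin n) (Fin n) ℝ) (z w : Cn n) :
    matAct M (z + w) = matAct M z + matAct M w := by
  simp [matAct, Matrix.mulVec_add]

theorem matAct_smul (M : Matrix (Fin n) (Fin n) ℝ) (c : ℂ) (z : Cn n) :
    matAct M (c • z) = c • matAct M z := by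
  simp [matAct, Matrix.mulVec_smul]

/-- An essentially bounded matrix potential, symmetric almost everywhere, acts by multiplication as
a bounded symmetric operator. -/
theorem exists_multiplication_operator {V : ℝ → Matrix (Fin n) (Fin n) ℝ}
    (hV : ∀ i j, MemLp (fun x => V x i j) ⊤ (volume.restrict (Icc a b)))
    (hsymm : ∀ᵐ x ∂(volume.restrict (Icc a b)), (V x).IsSymm) :
    ∃ T : L2 n a b →L[ℂ] L2 n a b, T.IsSymmetric ∧
      ∀ u, ∀ᵐ x ∂(volume.restrict (Icc a b)), T u x = matAct (V x) (u x) := by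
  have hbd (i j : Fin n) :
      ∃ C : ℝ, ∀ᵐ x ∂(volume.restrict (Icc a b)), |V x i j| ≤ C := by
    refine ⟨(eLpNormEssSup (fun x => V x i j) (volume.restrict (Icc a b))).toReal, ?_⟩
    have hfin : eLpNormEssSup (fun x => V x i j) (volume.restrict (Icc a b)) ≠ ⊤ := by
      have := (hV i j).eLpNorm_ne_top
      rwa [eLpNorm_exponent_top] at this
    filter_upwards [ae_le_eLpNormEssSup (f := fun x => V x i j)
      (μ := volume.restrict (Icc a b))] with x hx
    rw [← Real.norm_eq_abs, ← toReal_enorm]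
    exact ENNReal.toReal_mono hfin hx
  choose C hC using hbd
  have hb : ∀ᵐ x ∂(volume.restrict (Icc a b)), ∀ z : Cn n,
      ‖matAct (V x) z‖ ≤ (∑ i, ∑ j, C i j) * ‖z‖ := by
    filter_upwards [ae_all_iff.2 fun i => ae_all_iff.2 fun j => hC i j] with x hx z
    refine (norm_matAct_le _ _).trans ?_
    gcongr with i _ j _
    exact hx i j
  have hmeas (u : L2 n a b) : AEStronglyMeasurable (fun x => matAct (V x) (u x))
      (volume.restrict (Icc a b)) := by
    have h1 : AEMeasurable (fun x => ((V x).map (fun t : ℝ => (t : ℂ))).mulVec (u x).ofLp)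
        (volume.restrict (Icc a b)) := by
      refine aemeasurable_pi_lambda _ fun i => ?_
      change AEMeasurable (fun x => ∑ j, (V x i j : ℂ) * u x j) _
      refine Finset.aemeasurable_fun_sum _ fun j _ => ?_
      refine AEMeasurable.mul ?_ ?_
      · exact Complex.measurable_ofReal.comp_aemeasurable (hV i j).aestronglyMeasurable.aemeasurable
      · exact (EuclideanSpace.proj (𝕜 := ℂ) j).continuous.measurable.comp_aemeasurable
          (Lp.aestronglyMeasurable u).aemeasurable
    exact ((PiLp.continuous_toLp 2 (fun _ : Fin n => ℂ)).measurable.comp_aemeasurable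
      h1).aestronglyMeasurable
  have hmem (u : L2 n a b) : MemLp (fun x => matAct (V x) (u x)) 2 (volume.restrict (Icc a b)) := by
    refine MemLp.of_le_mul (Lp.memLp u) (hmeas u) (c := ∑ i, ∑ j, C i j) ?_
    filter_upwards [hb] with x hx using hx _
  let T : L2 n a b →L[ℂ] L2 n a b := LinearMap.mkContinuous
    { toFun := fun u => (hmem u).toLp _
      map_add' := fun u v => by
        refine Lp.ext ?_
        filter_upwards [(hmem (u + v)).coeFn_toLp, (hmem u).coeFn_toLp, (hmem v).coeFn_toLp,
          Lp.coeFn_add u v, Lp.coeFn_add ((hmem u).toLp _) ((hmem v).toLp _)] with x h1 h2 h3 h4 h5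
        rw [h1, h5, Pi.add_apply, h2, h3, h4, Pi.add_apply, matAct_add]
      map_smul' := fun c u => by
        refine Lp.ext ?_
        filter_upwards [(hmem (c • u)).coeFn_toLp, (hmem u).coeFn_toLp, Lp.coeFn_smul c u,
          Lp.coeFn_smul c ((hmem u).toLp _)] with x h1 h2 h3 h4
        rw [h1, RingHom.id_apply, h4, Pi.smul_apply, h2, h3, Pi.smul_apply, matAct_smul] }
    (∑ i, ∑ j, C i j) fun u => by
      refine Lp.norm_le_mul_norm_of_ae_le_mul ?_
      filter_upwards [(hmem u).coeFn_toLp, hb] with x h1 h2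
      change ‖((hmem u).toLp _ : L2 n a b) x‖ ≤ _
      rw [h1]
      exact h2 _
  have hT (u : L2 n a b) : ∀ᵐ x ∂(volume.restrict (Icc a b)), T u x = matAct (V x) (u x) :=
    (hmem u).coeFn_toLp
  refine ⟨T, fun u v => ?_, hT⟩
  change ⟪T u, v⟫_ℂ = ⟪u, T v⟫_ℂ
  rw [L2.inner_def, L2.inner_def]
  refine integral_congr_ae ?_
  filter_upwards [hT u, hT v, hsymm] with x h1 h2 h3
  rw [h1, h2, inner_matAct_left h3]

theorem mem_potentialGraph_iff {V : ℝ → Matrix (Fin n) (Fin n) ℝ} {T : L2 n a b →L[ℂ] L2 n a b}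
    (hT : ∀ u, ∀ᵐ x ∂(volume.restrict (Icc a b)), T u x = matAct (V x) (u x)) {u w : L2 n a b} :
    (u, w) ∈ potentialGraph a b V ↔ w = T u := by
  constructor
  · intro h
    refine Lp.ext ?_
    filter_upwards [hT u, h] with x h1 h2
    exact h2.trans h1.symm
  · rintro rfl
    exact hT u

theorem mem_eigenspace_iff {E : Type*} [AddCommGroup E] [Module ℂ E] {S : E →ₗ.[ℂ] E} {z : ℂ}
    {u : E} : u ∈ eigenspace S z ↔ (u, z • u) ∈ S.graph := by
  rw [LinearPMap.mem_graph_iff, eigenspace, Submodule.mem_map]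
  constructor
  · rintro ⟨y, hy, rfl⟩
    exact ⟨y, rfl, sub_eq_zero.1 hy⟩
  · rintro ⟨y, rfl, hy⟩
    exact ⟨y, sub_eq_zero.2 hy, rfl⟩

theorem mem_graph_schrodinger_iff {V : ℝ → Matrix (Fin n) (Fin n) ℝ}
    {T : L2 n a b →L[ℂ] L2 n a b}
    (hT : ∀ u, ∀ᵐ x ∂(volume.restrict (Icc a b)), T u x = matAct (V x) (u x)) {θ : ℝ}
    {u w : L2 n a b} :
    (u, w) ∈ (schrodinger a b V θ).graph ↔ (u, w - T u) ∈ laplacianGraph n a b θ := by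
  have hpot : ∀ v w, (v, w) ∈ (potential a b V).graph ↔ w = T v := fun v w => by
    rw [potential_graph, mem_potentialGraph_iff hT]
  rw [← laplacian_graph, LinearPMap.mem_graph_iff, LinearPMap.mem_graph_iff]
  constructor
  · rintro ⟨⟨y, hy1, hy2⟩, rfl, hy⟩
    refine ⟨⟨y, hy1⟩, rfl, ?_⟩
    have h1 := (hpot _ _).1 ((potential a b V).mem_graph ⟨y, hy2⟩)
    have h2 : laplacian n a b θ ⟨y, hy1⟩ + potential a b V ⟨y, hy2⟩ = w := hy
    rw [← h2, h1, add_sub_cancel_right]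
  · rintro ⟨⟨y, hy1⟩, rfl, hy⟩
    obtain ⟨⟨v, hv⟩, hvy, hvT⟩ := (LinearPMap.mem_graph_iff _).1 ((hpot y (T y)).2 rfl)
    simp only at hvy hvT hy
    subst hvy
    refine ⟨⟨v, hy1, hv⟩, rfl, ?_⟩
    change laplacian n a b θ ⟨v, hy1⟩ + potential a b V ⟨v, hv⟩ = w
    rw [hy, hvT, sub_add_cancel]

end Potential

/-! ### The quadratic form of the Schrödinger operator -/

section SchrodingerForm

variable {n : ℕ} {a b : ℝ}

/-- The bounded operator on `H¹` which represents the form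
`∫ |u'|² + ⟪u, V u⟫ + c |u|²`, where `T` is multiplication by `V`. -/
def formOp (T : L2 n a b →L[ℂ] L2 n a b) (c : ℝ) : H1 n a b →L[ℂ] H1 n a b :=
  ContinuousLinearMap.adjoint (WithLp.fstL 2 ℂ (L2 n a b) (Cn n))
      ∘L WithLp.fstL 2 ℂ (L2 n a b) (Cn n)
    + ContinuousLinearMap.adjoint (embL n a b)
      ∘L (T + (c : ℂ) • ContinuousLinearMap.id ℂ (L2 n a b)) ∘L embL n a b

theorem inner_formOp (T : L2 n a b →L[ℂ] L2 n a b) (c : ℝ) (p q : H1 n a b) :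
    ⟪p, formOp T c q⟫_ℂ = ⟪p.fst, q.fst⟫_ℂ
      + ⟪embL n a b p, T (embL n a b q) + (c : ℂ) • embL n a b q⟫_ℂ := by
  simp only [formOp, add_apply, ContinuousLinearMap.comp_apply,
    inner_add_right, ContinuousLinearMap.adjoint_inner_right]
  rfl

theorem le_re_inner_formOp {T : L2 n a b →L[ℂ] L2 n a b} {c : ℝ} (hc : ‖T‖ + 1 ≤ c)
    (p : H1 n a b) :
    ‖p.fst‖ ^ 2 + ‖embL n a b p‖ ^ 2 ≤ RCLike.re ⟪p, formOp T c p⟫_ℂ := by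
  rw [inner_formOp, inner_add_right, inner_smul_right, map_add, map_add, inner_self_eq_norm_sq,
    RCLike.re_to_complex, RCLike.re_to_complex, Complex.re_ofReal_mul, ← RCLike.re_to_complex,
    ← RCLike.re_to_complex, inner_self_eq_norm_sq]
  set u := embL n a b p
  have h1 : |RCLike.re ⟪u, T u⟫_ℂ| ≤ ‖u‖ * (‖T‖ * ‖u‖) :=
    (RCLike.abs_re_le_norm _).trans ((norm_inner_le_norm _ _).trans
      (mul_le_mul_of_nonneg_left (T.le_opNorm u) (norm_nonneg _)))
  have h2 := (abs_le.1 h1).1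
  nlinarith [sq_nonneg ‖u‖]

theorem isPositive_formOp {T : L2 n a b →L[ℂ] L2 n a b} (hT : T.IsSymmetric) {c : ℝ}
    (hc : ‖T‖ + 1 ≤ c) : (formOp T c).IsPositive := by
  refine ⟨fun p q => ?_, fun p => ?_⟩
  · change ⟪formOp T c p, q⟫_ℂ = ⟪p, formOp T c q⟫_ℂ
    have h1 (u v : L2 n a b) : ⟪T u, v⟫_ℂ = ⟪u, T v⟫_ℂ := hT u v
    rw [← inner_conj_symm, inner_formOp, inner_formOp, map_add, inner_conj_symm, inner_conj_symm,
      inner_add_left, inner_add_right, inner_smul_left, inner_smul_right, Complex.conj_ofReal, h1]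
  · change 0 ≤ RCLike.re ⟪formOp T c p, p⟫_ℂ
    rw [inner_re_symm]
    exact le_trans (by positivity) (le_re_inner_formOp hc p)

/-- The form is coercive: the value `u(a)` is controlled by `u` and `u'`. -/
theorem exists_coercive_formOp (hab : a < b) {T : L2 n a b →L[ℂ] L2 n a b} {c : ℝ}
    (hc : ‖T‖ + 1 ≤ c) :
    ∃ δ > 0, ∀ p, δ * ‖p‖ ^ 2 ≤ RCLike.re ⟪p, formOp T c p⟫_ℂ := by
  set M := (b - a)⁻¹ * ‖intL n a b‖ * (1 + ‖primL n a b‖) with hM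
  have hba : 0 < b - a := sub_pos.2 hab
  have hM0 : 0 ≤ M := by positivity
  have hsnd (p : H1 n a b) : ‖p.snd‖ ≤ M * (‖p.fst‖ + ‖embL n a b p‖) := by
    have h1 : ((b - a : ℝ) : ℂ) • p.snd
        = intL n a b (embL n a b p - primL n a b p.fst) := by
      rw [embL_apply, add_sub_cancel_right, intL_constL hab.le]
    have h2 : (b - a) * ‖p.snd‖ ≤ ‖intL n a b‖ * (‖embL n a b p‖ + ‖primL n a b‖ * ‖p.fst‖) := by
      calc (b - a) * ‖p.snd‖ = ‖((b - a : ℝ) : ℂ) • p.snd‖ := by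
            rw [norm_smul, Complex.norm_real, Real.norm_of_nonneg hba.le]
        _ ≤ ‖intL n a b‖ * ‖embL n a b p - primL n a b p.fst‖ := by
            rw [h1]; exact ContinuousLinearMap.le_opNorm _ _
        _ ≤ _ := by
            gcongr
            exact (norm_sub_le _ _).trans (by gcongr; exact ContinuousLinearMap.le_opNorm _ _)
    have h3 : ‖embL n a b p‖ + ‖primL n a b‖ * ‖p.fst‖
        ≤ (1 + ‖primL n a b‖) * (‖p.fst‖ + ‖embL n a b p‖) := by
      have h4 : 0 ≤ ‖primL n a b‖ * ‖embL n a b p‖ := by positivity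
      nlinarith [norm_nonneg p.fst]
    calc ‖p.snd‖ = (b - a)⁻¹ * ((b - a) * ‖p.snd‖) := by rw [inv_mul_cancel_left₀ hba.ne']
      _ ≤ (b - a)⁻¹ * (‖intL n a b‖ * ((1 + ‖primL n a b‖) * (‖p.fst‖ + ‖embL n a b p‖))) := by
          have := h2.trans (mul_le_mul_of_nonneg_left h3 (norm_nonneg _))
          gcongr
      _ = M * (‖p.fst‖ + ‖embL n a b p‖) := by rw [hM]; ring
  refine ⟨(1 + 2 * M ^ 2)⁻¹, by positivity, fun p => ?_⟩
  refine le_trans ?_ (le_re_inner_formOp hc p)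
  rw [inv_mul_le_iff₀ (by positivity), WithLp.prod_norm_sq_eq_of_L2]
  have h1 : ‖p.snd‖ ^ 2 ≤ M ^ 2 * (2 * (‖p.fst‖ ^ 2 + ‖embL n a b p‖ ^ 2)) := by
    calc ‖p.snd‖ ^ 2 ≤ (M * (‖p.fst‖ + ‖embL n a b p‖)) ^ 2 := by gcongr; exact hsnd p
      _ = M ^ 2 * (‖p.fst‖ + ‖embL n a b p‖) ^ 2 := mul_pow _ _ _
      _ ≤ _ := by gcongr; exact add_sq_le
  nlinarith [sq_nonneg ‖embL n a b p‖]

/-- The operator `J ∘ τ` of the form is the resolvent `(H_θ + c)⁻¹`: the eigenspaces agree. -/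
theorem eigenspace_schrodinger_eq (hab : a < b) {V : ℝ → Matrix (Fin n) (Fin n) ℝ}
    {T : L2 n a b →L[ℂ] L2 n a b}
    (hT : ∀ u, ∀ᵐ x ∂(volume.restrict (Icc a b)), T u x = matAct (V x) (u x)) {c θ : ℝ}
    (hc : ‖T‖ + 1 ≤ c) {τ : L2 n a b →L[ℂ] H1 n a b}
    (hτ : IsFormResolvent (formOp T c) (embL n a b) (formDomain n a b θ) τ) (l : ℝ) :
    eigenspace (schrodinger a b V θ) (l : ℂ) = invEigenspace (embL n a b ∘L τ) c l := by
  obtain ⟨δ, hδ, hcoer⟩ := exists_coercive_formOp hab hc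
  ext u
  rw [mem_eigenspace_iff, mem_graph_schrodinger_iff hT, mem_laplacianGraph_iff_weak hab,
    mem_invEigenspace]
  have hform (φ p : H1 n a b) (hp : embL n a b p = u) :
      ⟪φ.fst, p.fst⟫_ℂ = ⟪embL n a b φ, (l : ℂ) • u - T u⟫_ℂ ↔
        ⟪φ, formOp T c p⟫_ℂ = ⟪embL n a b φ, ((l + c : ℝ) : ℂ) • u⟫_ℂ := by
    rw [inner_formOp, hp, Complex.ofReal_add, add_smul, inner_sub_right, inner_add_right,
      inner_add_right]
    constructor <;> intro h <;> linear_combination h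
  change _ ↔ ((l + c : ℝ) : ℂ) • embL n a b (τ u) = u
  rw [← map_smul, ← map_smul]
  constructor
  · rintro ⟨p, hp, hpu, hw⟩
    rw [← hτ.eq_of_weak hδ hcoer hp fun φ hφ => (hform φ p hpu).1 (hw φ hφ), hpu]
  · intro h
    exact ⟨_, hτ.mem _, h, fun φ hφ => (hform φ _ h).2 (hτ.weak _ φ hφ)⟩

end SchrodingerForm

/-! ### Eigenvalue counting -/

section Counting

variable {n : ℕ} {a b : ℝ} {V : ℝ → Matrix (Fin n) (Fin n) ℝ}

/-- Below any `r`, the eigenspaces of `H_θ` are those of a compact positive operator `G`. -/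
theorem exists_resolvent (hab : a < b)
    (hV : ∀ i j, MemLp (fun x => V x i j) ⊤ (volume.restrict (Icc a b)))
    (hsymm : ∀ᵐ x ∂(volume.restrict (Icc a b)), (V x).IsSymm) (r : ℝ) :
    ∃ (A : H1 n a b →L[ℂ] H1 n a b) (c : ℝ), A.IsPositive ∧ 0 < r + c ∧
      ∀ θ : ℝ, ∃ τ : L2 n a b →L[ℂ] H1 n a b,
        IsFormResolvent A (embL n a b) (formDomain n a b θ) τ ∧
        ∀ l : ℝ, eigenspace (schrodinger a b V θ) (l : ℂ)
          = invEigenspace (embL n a b ∘L τ) c l := by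
  obtain ⟨T, hTs, hT⟩ := exists_multiplication_operator hV hsymm
  -- The first bound makes the form coercive, the second one makes `r + c` positive.
  set c := max (‖T‖ + 1) (1 - r) with hcdef
  have hc : ‖T‖ + 1 ≤ c := le_max_left _ _
  have hr : 0 < r + c := by linarith [le_max_right (‖T‖ + 1) (1 - r)]
  obtain ⟨δ, hδ, hcoer⟩ := exists_coercive_formOp hab hc
  refine ⟨formOp T c, c, isPositive_formOp hTs hc, hr, fun θ => ?_⟩
  obtain ⟨τ, hτ⟩ := exists_isFormResolvent (formOp T c) (embL n a b) (formDomain n a b θ)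
    (isClosed_formDomain θ) hδ hcoer
  exact ⟨τ, hτ, eigenspace_schrodinger_eq hab hT hc hτ⟩

theorem finiteDimensional_eigenspace_schrodinger (hab : a < b)
    (hV : ∀ i j, MemLp (fun x => V x i j) ⊤ (volume.restrict (Icc a b)))
    (hsymm : ∀ᵐ x ∂(volume.restrict (Icc a b)), (V x).IsSymm) (θ l : ℝ) :
    FiniteDimensional ℂ (eigenspace (schrodinger a b V θ) (l : ℂ)) := by
  obtain ⟨A, c, hA, hr, H⟩ := exists_resolvent hab hV hsymm (l + 1)
  obtain ⟨τ, hτ, hE⟩ := H θ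
  rw [hE]
  exact finiteDimensional_invEigenspace (hτ.isPositive hA)
    ((isCompactOperator_embL hab.le).comp_clm τ) hr (lt_add_one l)

theorem finite_setOf_eigenspace_schrodinger_ne_bot (hab : a < b)
    (hV : ∀ i j, MemLp (fun x => V x i j) ⊤ (volume.restrict (Icc a b)))
    (hsymm : ∀ᵐ x ∂(volume.restrict (Icc a b)), (V x).IsSymm) (θ r : ℝ) :
    {l : ℝ | l < r ∧ eigenspace (schrodinger a b V θ) (l : ℂ) ≠ ⊥}.Finite := by
  obtain ⟨A, c, hA, hr, H⟩ := exists_resolvent hab hV hsymm r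
  obtain ⟨τ, hτ, hE⟩ := H θ
  simp only [hE]
  exact finite_setOf_invEigenspace_ne_bot (hτ.isPositive hA)
    ((isCompactOperator_embL hab.le).comp_clm τ) hr

/-- The bound holds for all quasi-momenta: functions with `u(a) = 0` in one form domain satisfy
`u(a) = u(b) = 0`, and therefore belong to all the others. -/
theorem count_le_count_add (hab : a < b)
    (hV : ∀ i j, MemLp (fun x => V x i j) ⊤ (volume.restrict (Icc a b)))
    (hsymm : ∀ᵐ x ∂(volume.restrict (Icc a b)), (V x).IsSymm) (r θ₁ θ₂ : ℝ) :
    count a b V r θ₁ ≤ count a b V r θ₂ + n := by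
  obtain ⟨A, c, hA, hr, H⟩ := exists_resolvent hab hV hsymm r
  have hJ := isCompactOperator_embL (n := n) hab.le
  obtain ⟨τ₁, hτ₁, hE₁⟩ := H θ₁
  obtain ⟨τ₂, hτ₂, hE₂⟩ := H θ₂
  have h := finrank_spectralBelow_le hτ₁ hτ₂ hA hJ
    (WithLp.sndL 2 ℂ (L2 n a b) (Cn n)).toLinearMap (fun p hp hp0 => by
      have hp0' : p.snd = 0 := hp0
      rw [mem_formDomain, hp0', smul_zero] at hp ⊢
      exact hp) hr
  rw [← finsum_finrank_invEigenspace (hτ₁.isPositive hA) (hJ.comp_clm τ₁) hr,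
    ← finsum_finrank_invEigenspace (hτ₂.isPositive hA) (hJ.comp_clm τ₂) hr,
    finrank_euclideanSpace_fin] at h
  have hm₁ (l : ℝ) : mult a b V θ₁ l = Module.finrank ℂ (invEigenspace (embL n a b ∘L τ₁) c l) := by
    rw [mult, hE₁]
  have hm₂ (l : ℝ) : mult a b V θ₂ l = Module.finrank ℂ (invEigenspace (embL n a b ∘L τ₂) c l) := by
    rw [mult, hE₂]
  simp only [count, hm₁, hm₂]
  exact h

theorem abs_count_sub_count_le (hab : a < b)
    (hV : ∀ i j, MemLp (fun x => V x i j) ⊤ (volume.restrict (Icc a b)))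
    (hsymm : ∀ᵐ x ∂(volume.restrict (Icc a b)), (V x).IsSymm) (r θ₁ θ₂ : ℝ) :
    |(count a b V r θ₂ : ℤ) - count a b V r θ₁| ≤ n := by
  have h1 := count_le_count_add hab hV hsymm r θ₁ θ₂
  have h2 := count_le_count_add hab hV hsymm r θ₂ θ₁
  rw [abs_le]
  omega

theorem count_eq_count_add_countIco (hab : a < b)
    (hV : ∀ i j, MemLp (fun x => V x i j) ⊤ (volume.restrict (Icc a b)))
    (hsymm : ∀ᵐ x ∂(volume.restrict (Icc a b)), (V x).IsSymm) {r₁ r₂ : ℝ} (hr : r₁ ≤ r₂) (θ : ℝ) :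
    count a b V r₂ θ = count a b V r₁ θ + countIco a b V r₁ r₂ θ := by
  have hfin : (Iio r₂ ∩ Function.support fun l => mult a b V θ l).Finite := by
    refine (finite_setOf_eigenspace_schrodinger_ne_bot hab hV hsymm θ r₂).subset ?_
    rintro l ⟨hl, hl0⟩
    refine ⟨hl, fun h => hl0 ?_⟩
    change Module.finrank ℂ (eigenspace (schrodinger a b V θ) (l : ℂ)) = 0
    rw [h, finrank_bot]
  rw [count, count, countIco, ← Iio_union_Ico_eq_Iio hr]
  refine finsum_mem_union' ?_ (hfin.subset ?_) (hfin.subset ?_)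
  · exact disjoint_left.2 fun l h1 h2 => not_le.2 h1 h2.1
  · exact inter_subset_inter_left _ (Iio_subset_Iio hr)
  · exact inter_subset_inter_left _ Ico_subset_Iio_self

theorem abs_countIco_sub_countIco_le (hab : a < b)
    (hV : ∀ i j, MemLp (fun x => V x i j) ⊤ (volume.restrict (Icc a b)))
    (hsymm : ∀ᵐ x ∂(volume.restrict (Icc a b)), (V x).IsSymm) {r₁ r₂ : ℝ} (hr : r₁ ≤ r₂)
    (θ₁ θ₂ : ℝ) :
    |(countIco a b V r₁ r₂ θ₂ : ℤ) - countIco a b V r₁ r₂ θ₁| ≤ 2 * n := by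
  have h1 := abs_le.1 (abs_count_sub_count_le hab hV hsymm r₁ θ₁ θ₂)
  have h2 := abs_le.1 (abs_count_sub_count_le hab hV hsymm r₂ θ₁ θ₂)
  have h3 := count_eq_count_add_countIco hab hV hsymm hr θ₁
  have h4 := count_eq_count_add_countIco hab hV hsymm hr θ₂
  rw [abs_le]
  omega

end Counting

end ThetaSchrodinger

end

theorem corollary3p4 (n : ℕ) (a b : ℝ) (hab : a < b) (V : ℝ → Matrix (Fin n) (Fin n) ℝ)
    (hV : ∀ i j, MeasureTheory.MemLp (fun x => V x i j) ⊤
      (MeasureTheory.volume.restrict (Set.Icc a b)))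
    (hsymm : ∀ᵐ x ∂(MeasureTheory.volume.restrict (Set.Icc a b)), (V x).IsSymm) :
    -- the counting functions are well defined: all the sums are finite
    (∀ θ : ℝ, 0 ≤ θ → θ < 2 * Real.pi →
      (∀ l : ℝ, FiniteDimensional ℂ
        (ThetaSchrodinger.eigenspace (ThetaSchrodinger.schrodinger a b V θ) (l : ℂ))) ∧
      (∀ r : ℝ, {l : ℝ | l < r ∧
        ThetaSchrodinger.eigenspace (ThetaSchrodinger.schrodinger a b V θ) (l : ℂ) ≠ ⊥}.Finite)) ∧
    -- the bounds for all quasi-momenta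
    (∀ θ₁ θ₂ : ℝ, 0 ≤ θ₁ → θ₁ < θ₂ → θ₂ < 2 * Real.pi →
      (∀ r : ℝ,
        |(ThetaSchrodinger.count a b V r θ₂ : ℤ) - ThetaSchrodinger.count a b V r θ₁| ≤ 2 * n) ∧
      (∀ r₁ r₂ : ℝ, r₁ < r₂ →
        |(ThetaSchrodinger.countIco a b V r₁ r₂ θ₂ : ℤ)
          - ThetaSchrodinger.countIco a b V r₁ r₂ θ₁| ≤ 4 * n)) ∧
    -- the improved bounds
    (∀ θ₁ θ₂ : ℝ,
      ((0 < θ₁ ∧ θ₁ < θ₂ ∧ θ₂ < Real.pi) ∨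
        (Real.pi < θ₁ ∧ θ₁ < θ₂ ∧ θ₂ < 2 * Real.pi)) →
      (∀ r : ℝ,
        |(ThetaSchrodinger.count a b V r θ₂ : ℤ) - ThetaSchrodinger.count a b V r θ₁| ≤ n) ∧
      (∀ r₁ r₂ : ℝ, r₁ < r₂ →
        |(ThetaSchrodinger.countIco a b V r₁ r₂ θ₂ : ℤ)
          - ThetaSchrodinger.countIco a b V r₁ r₂ θ₁| ≤ 2 * n)) := by
  open ThetaSchrodinger in
  refine ⟨fun θ _ _ => ⟨finiteDimensional_eigenspace_schrodinger hab hV hsymm θ,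
    finite_setOf_eigenspace_schrodinger_ne_bot hab hV hsymm θ⟩,
    fun θ₁ θ₂ _ _ _ => ⟨fun r => ?_, fun r₁ r₂ hr => ?_⟩,
    fun θ₁ θ₂ _ => ⟨fun r => abs_count_sub_count_le hab hV hsymm r θ₁ θ₂,
      fun r₁ r₂ hr => abs_countIco_sub_countIco_le hab hV hsymm hr.le θ₁ θ₂⟩⟩
  · have := ThetaSchrodinger.abs_count_sub_count_le hab hV hsymm r θ₁ θ₂
    omega
  · have := ThetaSchrodinger.abs_countIco_sub_countIco_le hab hV hsymm hr.le θ₁ θ₂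
    omega
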